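/- Let $d\ge 2$, let $G$ be a finite simple graph with at least $d+1$ vertices (for instance $d=2$ and at least three vertices), and let $p$ assign to each vertex $v$ a point $p(v)\in\mathbb{R}^d$ so that the framework $(G,p)$ is generic (the coordinates of all the vertices, taken together, are algebraically independent over $\mathbb{Q}$) and isostatic (every infinitesimal motion of $(G,p)$ is the restriction of an infinitesimal rigid motion of $\mathbb{R}^d$, and this fails after the deletion of any edge). Let $ab$ be an edge of $G$ and let $G-ab$ be the graph with this edge removed. Let $X$ be the configuration space of the resulting mechanism: the set of all placements $q$ of the vertices in $\mathbb{R}^d$ with $|q(v)-q(w)|=|p(v)-p(w)|$ for every edge $vw$ of $G-ab$, modulo trivial motions (rotations and translations of $\mathbb{R}^d$), with the quotient topology. Then $X$ has finitely many connected components, each of them is a closed curve (homeomorphic to a circle), and on each of them, in particular on the curve through the original configuration $p$, the number of configurations $q$ in which the removed edge has its original length, $|q(a)-q(b)|=|p(a)-p(b)|$, is finite and even. -/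

import Mathlib

/-- A placement of the vertex set `V` in Euclidean `d`-space. A framework `(G, p)` is a simple
graph `G` on `V` together with a placement `p`. -/
abbrev Placement (V : Type*) (d : ℕ) : Type _ := V → EuclideanSpace ℝ (Fin d)

/-- A placement is generic if its coordinates, taken together, are algebraically independent
over `ℚ`. -/
def IsGenericPlacement {V : Type*} {d : ℕ} (p : Placement V d) : Prop :=
  AlgebraicIndependent ℚ (fun i : V × Fin d => p i.1 i.2)

/-- Velocities `u` that preserve all edge lengths of the framework `(G, p)` to first order. -/
def IsInfinitesimalMotion {V : Type*} {d : ℕ} (G : SimpleGraph V) (p u : Placement V d) : Prop :=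
  ∀ v w : V, G.Adj v w → inner ℝ (p v - p w) (u v - u w) = 0

/-- Velocities induced by an infinitesimal rigid motion of the whole space: `A` is skew-symmetric
and `t` is a translation. -/
def IsTrivialInfinitesimalMotion {V : Type*} {d : ℕ} (p u : Placement V d) : Prop :=
  ∃ (A : EuclideanSpace ℝ (Fin d) →ₗ[ℝ] EuclideanSpace ℝ (Fin d)) (t : EuclideanSpace ℝ (Fin d)),
    (∀ x y, inner ℝ (A x) y = -inner ℝ x (A y)) ∧ ∀ v, u v = A (p v) + t

/-- Infinitesimal rigidity of the framework `(G, p)`. -/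
def IsInfinitesimallyRigid {V : Type*} {d : ℕ} (G : SimpleGraph V) (p : Placement V d) : Prop :=
  ∀ u : Placement V d, IsInfinitesimalMotion G p u → IsTrivialInfinitesimalMotion p u

/-- The framework `(G, p)` is isostatic: it is (infinitesimally) rigid and has no redundant
edge. -/
def IsIsostatic {V : Type*} {d : ℕ} (G : SimpleGraph V) (p : Placement V d) : Prop :=
  IsInfinitesimallyRigid G p ∧
    ∀ e ∈ G.edgeSet, ¬ IsInfinitesimallyRigid (G.deleteEdges {e}) p

/-- The placements of `V` in which every edge of `G` has the length that it has in `p`. -/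
def EquivalentPlacements {V : Type*} {d : ℕ} (G : SimpleGraph V) (p : Placement V d) : Type _ :=
  {q : Placement V d // ∀ v w : V, G.Adj v w → dist (q v) (q w) = dist (p v) (p w)}

instance {V : Type*} {d : ℕ} (G : SimpleGraph V) (p : Placement V d) :
    TopologicalSpace (EquivalentPlacements G p) :=
  inferInstanceAs (TopologicalSpace
    {q : Placement V d // ∀ v w : V, G.Adj v w → dist (q v) (q w) = dist (p v) (p w)})

/-- `q'` arises from `q` by a trivial motion, that is, a rotation followed by a translation of
the whole space. -/
def DiffersByTrivialMotion {V : Type*} {d : ℕ} (q q' : Placement V d) : Prop :=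
  ∃ (R : EuclideanSpace ℝ (Fin d) ≃ₗᵢ[ℝ] EuclideanSpace ℝ (Fin d)) (t : EuclideanSpace ℝ (Fin d)),
    LinearMap.det (R.toLinearEquiv : EuclideanSpace ℝ (Fin d) →ₗ[ℝ] EuclideanSpace ℝ (Fin d)) = 1 ∧
      ∀ v, q' v = R (q v) + t

/-- Being related by a trivial motion, as an equivalence relation. -/
def trivialMotionSetoid {V : Type*} {d : ℕ} (G : SimpleGraph V) (p : Placement V d) :
    Setoid (EquivalentPlacements G p) where
  r q q' := DiffersByTrivialMotion q.1 q'.1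
  iseqv :=
    { refl := fun q => ⟨LinearIsometryEquiv.refl ℝ _, 0, by
        constructor
        · exact LinearMap.det_id
        · intro v; simp⟩
      symm := by
        rintro q q' ⟨R, t, hR, h⟩
        refine ⟨R.symm, -R.symm t, ?_, fun v => by simp [h v]⟩
        have h2 := LinearEquiv.det_symm_mul_det R.toLinearEquiv
        rw [hR, mul_one] at h2
        exact h2
      trans := by
        rintro q q' q'' ⟨R, t, hR, h⟩ ⟨S, s, hS, k⟩
        refine ⟨R.trans S, S t + s, ?_, fun v => by simp [h v, k v, add_assoc]⟩
        have h2 := LinearMap.det_comp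
          (S.toLinearEquiv : EuclideanSpace ℝ (Fin d) →ₗ[ℝ] EuclideanSpace ℝ (Fin d))
          (R.toLinearEquiv : EuclideanSpace ℝ (Fin d) →ₗ[ℝ] EuclideanSpace ℝ (Fin d))
        rw [hR, hS, mul_one] at h2
        exact h2 }

/-- The configuration space of the framework `(G, p)`: all placements with the same edge lengths,
modulo trivial motions, with the quotient topology. -/
def ConfigurationSpace {V : Type*} {d : ℕ} (G : SimpleGraph V) (p : Placement V d) : Type _ :=
  Quotient (trivialMotionSetoid G p)

instance {V : Type*} {d : ℕ} (G : SimpleGraph V) (p : Placement V d) :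
    TopologicalSpace (ConfigurationSpace G p) :=
  inferInstanceAs (TopologicalSpace (Quotient (trivialMotionSetoid G p)))

/-- The distance between the vertices `a` and `b` in a configuration. -/
noncomputable def ConfigurationSpace.vertexDist {V : Type*} {d : ℕ} {G : SimpleGraph V}
    {p : Placement V d} (a b : V) (x : ConfigurationSpace G p) : ℝ :=
  Quotient.lift (fun q : EquivalentPlacements G p => dist (q.1 a) (q.1 b))
    (by
      rintro q q' ⟨R, t, -, h⟩
      simp [h]) x

/-! Pass to placements with centroid at the origin and consider, at each placement `q`, the
velocities that preserve the edge lengths of `G - ab` to first order and have no linear or angular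
momentum (the kernel of `constraintMap`). Isostaticity of `(G, p)` makes the target of this map one
dimension smaller than its source, so a generalized cross product (`exists_cross_product`) yields a
kernel vector `W q` that is C¹ in `q`. Up to determinant factors `W` commutes with linear
isometries; these factors form a character of the orthogonal group, which is trivial on rotations
(`map_eq_one_of_det_eq_one`).

Genericity enters only through `rigidityMap_surjective_of_isGenericPlacement`. Write `R_q` for the
rigidity map at `q`. If `q` has the edge lengths of `p`, a derivation `D` of `ℝ` over `ℚ` with `D p
= u` turns the equations `|q v - q w|² = |p v - p w|²` into `R_q (D q) = R_p u`. As `u` is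
arbitrary, `R_q` is onto whenever `R_p` is. Hence `W` has no zeros on the centered placements of the
mechanism.

The flow of `W`, after a cutoff, preserves these placements and descends to an action of `ℝ` on the
configuration space. Nearby configurations are reached by flowing for a short time
(`IsGlobalFlow.eventually_exists_rigidMotion`), so orbit maps are open and the orbits are the
connected components. The space is compact because `G - ab` is connected, so there are finitely many
components. A momentum-free motion that keeps all distances has velocity zero
(`eq_zero_of_momentMap_of_dist_const`), so stabilizers are not dense; compactness rules out the
trivial stabilizer, and each orbit is a quotient of `ℝ` by a period, that is, a circle.

Along an orbit `|q a - q b|² - |p a - p b|²` is periodic. At a multiple zero all lengths of `G`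
would be the original ones and `W q` would lie in the kernel of the constraint map of `G`, which is
injective there, again by genericity. So all zeros are simple, the function changes sign at each,
and their number in a period is even. -/

/-! ### Derivations of the reals -/

section

open KaehlerDifferential in
/-- Derivations of `ℝ` may be prescribed freely on an algebraically independent family. -/
theorem AlgebraicIndependent.exists_derivation {ι : Type*} {x : ι → ℝ}
    (hx : AlgebraicIndependent ℚ x) (u : ι → ℝ) :
    ∃ D : Derivation ℚ ℝ ℝ, ∀ i, D (x i) = u i := by
  classical
  obtain ⟨s, hs, hb⟩ := exists_isTranscendenceBasis_superset (R := ℚ) (A := ℝ)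
    (s := Set.range x) hx.to_subtype_range
  set v : s → ℝ := Subtype.val with hv
  have hv' : AlgebraicIndependent ℚ v := hb.1
  let A := MvPolynomial s ℚ
  let _ : Algebra A ℝ := (MvPolynomial.aeval v).toAlgebra
  have htower : IsScalarTower ℚ A ℝ := IsScalarTower.of_algebraMap_eq fun r =>
    ((MvPolynomial.aeval v).commutes r).symm
  have hinj : Function.Injective (algebraMap A ℝ) := hv'
  have hfaith : FaithfulSMul A ℝ := (faithfulSMul_iff_algebraMap_injective A ℝ).mpr hinj
  let K := FractionRing A
  let _ : Algebra K ℝ := FractionRing.liftAlgebra A ℝ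
  have : IsScalarTower A K ℝ := inferInstance
  have halgA : Algebra.IsAlgebraic A ℝ := by
    have h1 := hb.isAlgebraic
    exact Algebra.IsAlgebraic.of_ringHom_of_comp_eq
      (hv'.aevalEquiv : A →+* Algebra.adjoin ℚ (Set.range v)) (RingHom.id ℝ)
      hv'.aevalEquiv.surjective Function.injective_id (by
        ext y
        · simp
        · exact hv'.algebraMap_aevalEquiv _)
  have halg : Algebra.IsAlgebraic K ℝ := IsFractionRing.comap_isAlgebraic_iff.mp halgA
  have : CharZero K := inferInstance
  -- Localizations and separable algebraic extensions are formally étale (the characteristic is 0),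
  -- so `Ω[ℝ⁄ℚ]` is the base change of the differentials of the polynomial ring `A`, and derivations
  -- of `A` extend to `ℝ`.
  have : Algebra.FormallyEtale A K := .of_isLocalization (nonZeroDivisors A)
  have : Algebra.FormallyEtale K ℝ := Algebra.FormallyEtale.of_isSeparable K ℝ
  have : Algebra.FormallyEtale A ℝ := .comp A K ℝ
  -- On basis elements outside the given family any value would do; 0 is taken.
  let w : s → ℝ := fun y => if h : ∃ i, x i = y then u h.choose else 0
  let D0 : Derivation ℚ A ℝ := MvPolynomial.mkDerivation ℚ w
  let e := tensorKaehlerEquivOfFormallyEtale ℚ A ℝ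
  let l : Ω[ℝ⁄ℚ] →ₗ[ℝ] ℝ :=
    (LinearMap.liftBaseChange ℝ D0.liftKaehlerDifferential) ∘ₗ e.symm.toLinearMap
  refine ⟨l.compDer (D ℚ ℝ), fun i => ?_⟩
  have hmem : x i ∈ s := hs (Set.mem_range_self i)
  have h1 : x i = algebraMap A ℝ (MvPolynomial.X ⟨x i, hmem⟩) :=
    (MvPolynomial.aeval_X v ⟨x i, hmem⟩).symm
  have h2 : l (D ℚ ℝ (x i)) = w ⟨x i, hmem⟩ := by
    conv_lhs => rw [h1]
    simp only [l, LinearMap.comp_apply, LinearEquiv.coe_coe, e]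
    erw [tensorKaehlerEquivOfFormallyEtale_symm_D_algebraMap]
    simp only [LinearMap.liftBaseChange_tmul, one_smul, Derivation.liftKaehlerDifferential_comp_D]
    exact MvPolynomial.mkDerivation_X _ _ _
  have h3 : w ⟨x i, hmem⟩ = u i := by
    have hex : ∃ j, x j = (⟨x i, hmem⟩ : s) := ⟨i, rfl⟩
    simp only [w, dif_pos hex]
    congr 1
    exact hx.injective hex.choose_spec
  simpa [h3] using h2

end

/-! ### Global flows of bounded Lipschitz fields -/

section

open Filter Topology Set
open scoped NNReal

/-- A bounded Lipschitz vector field has global integral curves. -/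
theorem exists_hasDerivAt_of_lipschitz_of_bounded {E : Type*} [NormedAddCommGroup E]
    [NormedSpace ℝ E] [CompleteSpace E] {v : E → E} {K L : ℝ≥0} (hv : LipschitzWith K v)
    (hL : ∀ x, ‖v x‖ ≤ L) (x : E) :
    ∃ γ : ℝ → E, γ 0 = x ∧ ∀ t, HasDerivAt γ (v (γ t)) t := by
  have hloc : ∀ T : ℝ, 0 < T → ∃ α : ℝ → E, α 0 = x ∧
      ∀ t ∈ Ioo (-T) T, HasDerivAt α (v (α t)) t := by
    intro T hT
    -- In time `T` a curve of speed at most `L` stays within distance `L * T`, so boundedness allows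
    -- an interval of any length.
    have hpl : IsPicardLindelof (fun _ : ℝ => v) (tmin := -T) (tmax := T)
        ⟨0, by constructor <;> linarith⟩ x (L * T.toNNReal) 0 L K :=
      IsPicardLindelof.of_time_independent (fun y _ => hL y) hv.lipschitzOnWith
        (by simp [hT.le])
    obtain ⟨α, h0, hα⟩ := hpl.exists_eq_forall_mem_Icc_hasDerivWithinAt₀
    exact ⟨α, h0, fun t ht => (hα t (Ioo_subset_Icc_self ht)).hasDerivAt
      (Icc_mem_nhds ht.1 ht.2)⟩
  choose! α h0 hα using hloc
  have hagree : ∀ S T : ℝ, 0 < S → S ≤ T → EqOn (α S) (α T) (Ioo (-S) S) := by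
    intro S T hS hST
    refine ODE_solution_unique_of_mem_Ioo (v := fun _ => v) (s := fun _ => univ)
      (fun t _ => hv.lipschitzOnWith) (t₀ := 0) ⟨by linarith, hS⟩
      (fun t ht => ⟨hα S hS t ht, trivial⟩)
      (fun t ht => ⟨hα T (hS.trans_le hST) t ⟨by linarith [ht.1], by linarith [ht.2]⟩, trivial⟩)
      (by rw [h0 S hS, h0 T (hS.trans_le hST)])
  -- The radius `|t| + 1` keeps `t` in the open interval where the local solution is differentiable.
  refine ⟨fun t => α (|t| + 1) t, by simpa using h0 1 one_pos, fun t => ?_⟩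
  have hmem : t ∈ Ioo (-(|t| + 1)) (|t| + 1) := by
    constructor <;> linarith [neg_abs_le t, le_abs_self t]
  refine (hα (|t| + 1) (by positivity) t hmem).congr_of_eventuallyEq ?_
  filter_upwards [isOpen_Ioo.mem_nhds hmem] with s hs
  have hs' : s ∈ Ioo (-(|s| + 1)) (|s| + 1) := by
    constructor <;> linarith [neg_abs_le s, le_abs_self s]
  rcases le_total |s| |t| with h | h
  · exact hagree _ _ (by positivity) (by linarith) hs'
  · exact (hagree _ _ (by positivity) (by linarith) hs).symm

/-- A global flow of the vector field `v`, given with the properties that determine it. -/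
structure IsGlobalFlow {E : Type*} [NormedAddCommGroup E] [NormedSpace ℝ E]
    (v : E → E) (φ : ℝ → E → E) : Prop where
  zero : ∀ x, φ 0 x = x
  deriv : ∀ x t, HasDerivAt (fun s => φ s x) (v (φ t x)) t

theorem exists_isGlobalFlow {E : Type*} [NormedAddCommGroup E]
    [NormedSpace ℝ E] [CompleteSpace E] {v : E → E} {K L : ℝ≥0} (hv : LipschitzWith K v)
    (hL : ∀ x, ‖v x‖ ≤ L) : ∃ φ : ℝ → E → E, IsGlobalFlow v φ := by
  choose γ h0 hγ using exists_hasDerivAt_of_lipschitz_of_bounded hv hL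
  exact ⟨fun t x => γ x t, h0, hγ⟩

namespace IsGlobalFlow

variable {E : Type*} [NormedAddCommGroup E] [NormedSpace ℝ E] {v : E → E} {φ : ℝ → E → E}
  {K : ℝ≥0}

theorem eq_of_hasDerivAt (h : IsGlobalFlow v φ) (hv : LipschitzWith K v) {γ : ℝ → E}
    (hγ : ∀ t, HasDerivAt γ (v (γ t)) t) (t : ℝ) : γ t = φ t (γ 0) := by
  have := ODE_solution_unique_univ (v := fun _ => v) (s := fun _ => univ)
      (fun t => hv.lipschitzOnWith) (t₀ := 0) (f := γ) (g := fun t => φ t (γ 0))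
      (fun t => ⟨hγ t, trivial⟩) (fun t => ⟨h.deriv _ t, trivial⟩) (h.zero _).symm
  exact congrFun this t

theorem add (h : IsGlobalFlow v φ) (hv : LipschitzWith K v) (s t : ℝ) (x : E) :
    φ (s + t) x = φ s (φ t x) := by
  have := h.eq_of_hasDerivAt hv (γ := fun s => φ (s + t) x)
    (fun s => (h.deriv x (s + t)).comp_add_const s t) s
  simpa using this

theorem map_linear (h : IsGlobalFlow v φ) (hv : LipschitzWith K v) (g : E →L[ℝ] E)
    (hg : ∀ x, v (g x) = g (v x)) (t : ℝ) (x : E) : φ t (g x) = g (φ t x) := by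
  have := h.eq_of_hasDerivAt hv (γ := fun s => g (φ s x))
    (fun s => by
      rw [hg]
      exact g.hasFDerivAt.comp_hasDerivAt s (h.deriv x s)) t
  simpa [h.zero] using this.symm

theorem continuous_left (h : IsGlobalFlow v φ) (x : E) : Continuous fun t => φ t x :=
  continuous_iff_continuousAt.2 fun t => (h.deriv x t).continuousAt

theorem neg_time (h : IsGlobalFlow v φ) : IsGlobalFlow (fun x => -v x) fun t => φ (-t) where
  zero x := by simpa using h.zero x
  deriv x t := by
    have := (h.deriv x (-t)).scomp t (hasDerivAt_neg t)
    simpa [Function.comp_def] using this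

theorem dist_le_of_nonneg (h : IsGlobalFlow v φ) (hv : LipschitzWith K v) (x y : E) {t : ℝ}
    (ht : 0 ≤ t) : dist (φ t x) (φ t y) ≤ dist x y * Real.exp (K * t) := by
  have := dist_le_of_trajectories_ODE (v := fun _ => v) (K := K) (a := 0) (b := t)
    (f := fun s => φ s x) (g := fun s => φ s y) (δ := dist x y) (fun _ => hv)
    (h.continuous_left x).continuousOn (fun s _ => (h.deriv x s).hasDerivWithinAt)
    (h.continuous_left y).continuousOn (fun s _ => (h.deriv y s).hasDerivWithinAt)
    (by simp [h.zero]) t ⟨ht, le_rfl⟩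
  simpa using this

theorem dist_le (h : IsGlobalFlow v φ) (hv : LipschitzWith K v) (x y : E) (t : ℝ) :
    dist (φ t x) (φ t y) ≤ dist x y * Real.exp (K * |t|) := by
  rcases le_total 0 t with ht | ht
  · simpa [abs_of_nonneg ht] using h.dist_le_of_nonneg hv x y ht
  · have := h.neg_time.dist_le_of_nonneg (K := K) hv.neg x y
      (t := -t) (by linarith)
    simpa [abs_of_nonpos ht] using this

/-- At time 0 the derivative is explicit, so a Lipschitz field suffices. The increment is split into
a change of time at a fixed point, controlled by continuity of `v`, and a change of point at a fixed
time, controlled by Grönwall. Strictness is what the surjective inverse function theorem needs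
later. -/
theorem hasStrictFDerivAt_zero (h : IsGlobalFlow v φ) (hv : LipschitzWith K v) (x : E) :
    HasStrictFDerivAt (fun z : ℝ × E => φ z.1 z.2)
      ((ContinuousLinearMap.fst ℝ ℝ E).smulRight (v x) + ContinuousLinearMap.snd ℝ ℝ E)
      (0, x) := by
  -- spatial increment at a fixed time
  have hspace : ∀ y z t, |t| ≤ 1 →
      ‖φ t y - φ t z - (y - z)‖ ≤ K * Real.exp K * |t| * ‖y - z‖ := by
    intro y z t ht
    have := (convex_uIcc (0 : ℝ) t).norm_image_sub_le_of_norm_hasDerivWithin_le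
      (f := fun s => φ s y - φ s z) (f' := fun s => v (φ s y) - v (φ s z))
      (C := K * (‖y - z‖ * Real.exp K)) (x := 0) (y := t)
      (fun s _ => ((h.deriv y s).sub (h.deriv z s)).hasDerivWithinAt)
      (fun s hs => by
        rw [← dist_eq_norm, ← dist_eq_norm]
        refine (hv.dist_le_mul _ _).trans ?_
        gcongr
        refine (h.dist_le hv y z s).trans ?_
        have hs1 : |s| ≤ 1 := by
          have := abs_sub_left_of_mem_uIcc hs
          simp at this
          exact this.trans ht
        gcongr
        nlinarith [K.2])
      left_mem_uIcc right_mem_uIcc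
    simp only [h.zero, sub_zero, Real.norm_eq_abs] at this
    refine this.trans (le_of_eq (by ring))
  have hcont : ContinuousAt (fun z : ℝ × E => φ z.1 z.2) (0, x) := by
    rw [Metric.continuousAt_iff']
    intro ε hε
    have h1 : ∀ᶠ z : ℝ × E in 𝓝 (0, x), dist (φ z.1 x) x < ε / 2 := by
      have : Tendsto (fun z : ℝ × E => φ z.1 x) (𝓝 (0, x)) (𝓝 x) := by
        have h2 := ((h.continuous_left x).comp continuous_fst).tendsto ((0 : ℝ), x)
        simpa [h.zero, Function.comp_def] using h2
      exact (Metric.tendsto_nhds.1 this) _ (half_pos hε)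
    have h2 : ∀ᶠ z : ℝ × E in 𝓝 (0, x), dist z.2 x * Real.exp (K * |z.1|) < ε / 2 := by
      have hc : Continuous fun z : ℝ × E => dist z.2 x * Real.exp (K * |z.1|) := by fun_prop
      have := hc.tendsto ((0 : ℝ), x)
      simp only [dist_self, zero_mul] at this
      exact this.eventually (gt_mem_nhds (half_pos hε))
    filter_upwards [h1, h2] with z hz1 hz2
    have := h.dist_le hv z.2 x z.1
    have h3 := dist_triangle (φ z.1 z.2) (φ z.1 x) x
    simp only [h.zero]
    linarith
  rw [hasStrictFDerivAt_iff_isLittleO, Asymptotics.isLittleO_iff]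
  intro c hc
  -- temporal increment
  have hvc : ∀ᶠ z : ℝ × E in 𝓝 (0, x), ‖v (φ z.1 z.2) - v x‖ < c / 2 := by
    have : Tendsto (fun z : ℝ × E => v (φ z.1 z.2)) (𝓝 (0, x)) (𝓝 (v x)) := by
      have h1 := hv.continuous.continuousAt.comp hcont
      have h2 := h1.tendsto
      simpa [Function.comp_def, h.zero] using h2
    have h3 := (Metric.tendsto_nhds.1 this) _ (half_pos hc)
    simpa [dist_eq_norm] using h3
  obtain ⟨δ, hδ, hball⟩ := Metric.eventually_nhds_iff_ball.1 hvc
  have hKc : 0 < c / 2 / (K * Real.exp K + 1) := by positivity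
  -- `δ` serves the time increment, `1` the bound `hspace`, and the last term makes the spatial
  -- error at most `c / 2`; the `+ 1` in its denominator covers `K = 0`.
  set η := min δ (min 1 (c / 2 / (K * Real.exp K + 1))) with hη
  have hη0 : 0 < η := lt_min hδ (lt_min one_pos hKc)
  have hB : Metric.ball ((0 : ℝ), x) η ×ˢ Metric.ball ((0 : ℝ), x) η ∈
      𝓝 (((0 : ℝ), x), ((0 : ℝ), x)) :=
    prod_mem_nhds (Metric.ball_mem_nhds _ hη0) (Metric.ball_mem_nhds _ hη0)
  filter_upwards [hB]
  rintro ⟨⟨t, y⟩, ⟨s, z⟩⟩ ⟨h1, h2⟩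
  simp only [Metric.mem_ball, Prod.dist_eq, max_lt_iff, Real.dist_eq, sub_zero] at h1 h2
  obtain ⟨ht, hy⟩ := h1
  obtain ⟨hs, hz⟩ := h2
  have htime : ‖φ t y - φ s y - (t - s) • v x‖ ≤ c / 2 * |t - s| := by
    have := (convex_uIcc s t).norm_image_sub_le_of_norm_hasDerivWithin_le
      (f := fun r => φ r y - r • v x) (f' := fun r => v (φ r y) - v x)
      (C := c / 2) (x := s) (y := t)
      (fun r _ => by
        have := (h.deriv y r).sub ((hasDerivAt_id r).smul_const (v x))
        simpa [Pi.sub_def] using this.hasDerivWithinAt)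
      (fun r hr => by
        refine (hball (r, y) ?_).le
        have hr1 : |r| < δ := by
          have h3 : |r| ≤ max |s| |t| := by
            rcases le_total s t with hst | hst
            · rw [uIcc_of_le hst] at hr; exact abs_le_max_abs_abs hr.1 hr.2
            · rw [uIcc_of_ge hst] at hr; rw [max_comm]; exact abs_le_max_abs_abs hr.1 hr.2
          exact h3.trans_lt ((max_lt hs ht).trans_le (min_le_left _ _))
        simp only [Metric.mem_ball, Prod.dist_eq, max_lt_iff, Real.dist_eq, sub_zero]
        exact ⟨hr1, hy.trans_le (min_le_left _ _)⟩)
      left_mem_uIcc right_mem_uIcc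
    rw [Real.norm_eq_abs] at this
    convert this using 2
    rw [sub_smul]; abel
  have hsp := hspace y z s (hs.le.trans ((min_le_right _ _).trans (min_le_left _ _)))
  have hs2 : |s| ≤ c / 2 / (K * Real.exp K + 1) :=
    hs.le.trans ((min_le_right _ _).trans (min_le_right _ _))
  have hKs : K * Real.exp K * |s| ≤ c / 2 := by
    rw [le_div_iff₀ (by positivity)] at hs2
    nlinarith [abs_nonneg s]
  have e1 : |t - s| ≤ ‖((t, y) : ℝ × E) - (s, z)‖ := by
    exact norm_fst_le (((t, y) : ℝ × E) - (s, z))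
  have e2 : ‖y - z‖ ≤ ‖((t, y) : ℝ × E) - (s, z)‖ := by
    exact norm_snd_le (((t, y) : ℝ × E) - (s, z))
  have hsum : φ t y - φ s z - ((t - s) • v x + (y - z)) =
      (φ t y - φ s y - (t - s) • v x) + (φ s y - φ s z - (y - z)) := by abel
  simp only [add_apply, ContinuousLinearMap.smulRight_apply,
    ContinuousLinearMap.coe_fst', ContinuousLinearMap.coe_snd', Prod.mk_sub_mk]
  rw [hsum]
  calc _ ≤ _ := norm_add_le _ _
    _ ≤ c / 2 * |t - s| + c / 2 * ‖y - z‖ := by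
        gcongr
        exact hsp.trans (by gcongr)
    _ ≤ c / 2 * ‖((t, y) : ℝ × E) - (s, z)‖ + c / 2 * ‖((t, y) : ℝ × E) - (s, z)‖ := by gcongr
    _ = _ := by rw [Prod.mk_sub_mk]; ring

end IsGlobalFlow

end

/-! ### Parity of simple zeros -/

section

open Filter Topology Set

/-- A continuous function whose zeros on `[a, b]` are simple and lie in the open interval changes
sign between `a` and `b` according to the parity of the number of zeros. -/
theorem even_card_zeros_iff {a b : ℝ} (hab : a ≤ b) (s : Finset ℝ) :
    ∀ f : ℝ → ℝ, Continuous f → f a ≠ 0 → f b ≠ 0 →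
      (∀ t, t ∈ s ↔ t ∈ Icc a b ∧ f t = 0) →
      (∀ t ∈ s, ∃ f', f' ≠ 0 ∧ HasDerivAt f f' t) →
      (Even s.card ↔ 0 < f a * f b) := by
  induction s using Finset.induction_on with
  | empty =>
    intro f hf ha hb hs _
    simp only [Finset.card_empty, Even.zero, true_iff]
    by_contra hneg
    have hneg' : f a * f b ≤ 0 := not_lt.1 hneg
    have hz : ∃ t ∈ Icc a b, f t = 0 := by
      rcases mul_nonpos_iff.1 hneg' with ⟨h1, h2⟩ | ⟨h1, h2⟩
      · exact intermediate_value_Icc' hab hf.continuousOn ⟨h2, h1⟩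
      · exact intermediate_value_Icc hab hf.continuousOn ⟨h1, h2⟩
    obtain ⟨t, ht, h0⟩ := hz
    simpa using (hs t).2 ⟨ht, h0⟩
  | insert z s hzs ih =>
    intro f hf ha hb hs hd
    obtain ⟨c, hc, hfz⟩ := hd z (Finset.mem_insert_self z s)
    obtain ⟨hzI, hz0⟩ := (hs z).1 (Finset.mem_insert_self z s)
    have hza : a < z := lt_of_le_of_ne hzI.1 (by rintro rfl; exact ha hz0)
    have hzb : z < b := lt_of_le_of_ne hzI.2 (by rintro rfl; exact hb hz0)
    -- Divide out the zero `z`: `dslope f z` is `f t / (t - z)`, with the nonzero value `c` at `z`.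
    -- It loses exactly the zero `z`, and the product of its end values has the opposite sign.
    have hne : ∀ t, t ≠ z → dslope f z t = (t - z)⁻¹ * f t := by
      intro t ht
      rw [dslope_of_ne _ ht, slope_def_field, hz0]
      ring
    have hcont : Continuous (dslope f z) := by
      rw [continuous_iff_continuousAt]
      intro t
      by_cases ht : t = z
      · subst ht; exact continuousAt_dslope_same.2 hfz.differentiableAt
      · exact (continuousAt_dslope_of_ne ht).2 hf.continuousAt
    have hgz : dslope f z z = c := by rw [dslope_same, hfz.deriv]
    have hga : dslope f z a = (a - z)⁻¹ * f a := hne a hza.ne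
    have hgb : dslope f z b = (b - z)⁻¹ * f b := hne b hzb.ne'
    have h1 : (a - z)⁻¹ < 0 := inv_lt_zero.2 (by linarith)
    have h2 : 0 < (b - z)⁻¹ := inv_pos.2 (by linarith)
    have key := ih (dslope f z) hcont (by rw [hga]; exact mul_ne_zero h1.ne ha)
      (by rw [hgb]; exact mul_ne_zero h2.ne' hb) (fun t => by
        by_cases ht : t = z
        · subst ht; exact iff_of_false hzs fun h => hc (hgz ▸ h.2)
        · rw [hne t ht, mul_eq_zero, inv_eq_zero, sub_eq_zero]
          have := hs t
          rw [Finset.mem_insert] at this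
          simpa [ht] using this)
      (fun t ht => by
        have htz : t ≠ z := by rintro rfl; exact hzs ht
        obtain ⟨f', hf', hft⟩ := hd t (Finset.mem_insert_of_mem ht)
        obtain ⟨-, ht0⟩ := (hs t).1 (Finset.mem_insert_of_mem ht)
        refine ⟨(t - z)⁻¹ * f', mul_ne_zero (inv_ne_zero (sub_ne_zero.2 htz)) hf', ?_⟩
        have hinv : HasDerivAt (fun x : ℝ => (x - z)⁻¹) (-1 / (t - z) ^ 2) t :=
          ((hasDerivAt_id t).sub_const z).inv (sub_ne_zero.2 htz)
        have := hinv.mul hft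
        rw [ht0, mul_zero, zero_add] at this
        refine this.congr_of_eventuallyEq ?_
        filter_upwards [isOpen_ne.mem_nhds htz] with x hx
        exact hne x hx)
    rw [Finset.card_insert_of_notMem hzs, Nat.even_add_one, key, hga, hgb, not_lt]
    have h3 : (a - z)⁻¹ * f a * ((b - z)⁻¹ * f b) = ((a - z)⁻¹ * (b - z)⁻¹) * (f a * f b) := by
      ring
    have h4 : (a - z)⁻¹ * (b - z)⁻¹ < 0 := mul_neg_of_neg_of_pos h1 h2
    have h5 : f a * f b ≠ 0 := mul_ne_zero ha hb
    rw [h3]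
    constructor
    · intro h
      rcases h5.lt_or_gt with h6 | h6
      · exact absurd (mul_pos_of_neg_of_neg h4 h6) (not_lt.2 h)
      · exact h6
    · intro h
      exact (mul_neg_of_neg_of_pos h4 h).le

/-- The zeros in a compact interval of a function with simple zeros are finite in number. -/
theorem finite_zeros_of_simple {f : ℝ → ℝ} (hf : Continuous f)
    (hd : ∀ t, f t = 0 → ∃ f', f' ≠ 0 ∧ HasDerivAt f f' t) (a b : ℝ) :
    {t ∈ Icc a b | f t = 0}.Finite := by
  have hcomp : IsCompact {t ∈ Icc a b | f t = 0} :=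
    isCompact_Icc.inter_right (isClosed_eq hf continuous_const)
  refine hcomp.finite ?_
  rw [isDiscrete_iff_nhdsNE]
  rintro t ⟨-, ht⟩
  obtain ⟨f', hf', hft⟩ := hd t ht
  have h1 := hft.eventually_ne hf' (c := 0)
  rw [Filter.inf_principal_eq_bot]
  filter_upwards [h1] with x hx hx2
  exact hx hx2.2

/-- A periodic function with simple zeros has an even number of zeros in a period. -/
theorem Function.Periodic.exists_even_card_zeros {f : ℝ → ℝ} {c : ℝ} (hc : 0 < c)
    (hper : Function.Periodic f c) (hf : Continuous f)
    (hd : ∀ t, f t = 0 → ∃ f', f' ≠ 0 ∧ HasDerivAt f f' t) :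
    ∃ a : ℝ, ∃ s : Finset ℝ, (∀ t, t ∈ s ↔ t ∈ Ico a (a + c) ∧ f t = 0) ∧ Even s.card := by
  have hfin := finite_zeros_of_simple hf hd
  -- Starting the period at a nonzero of `f` keeps zeros off both ends, and there `f a * f (a + c)`
  -- is a square.
  obtain ⟨a, ha⟩ : ∃ a, f a ≠ 0 := by
    by_contra! h
    have h1 := hfin 0 1
    have h2 : {t ∈ Icc (0 : ℝ) 1 | f t = 0} = Icc 0 1 := by ext t; simp [h]
    rw [h2] at h1
    exact (Icc_infinite one_pos) h1
  have hb : f (a + c) ≠ 0 := by rwa [hper a]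
  have hmem : ∀ t, t ∈ (hfin a (a + c)).toFinset ↔ t ∈ Icc a (a + c) ∧ f t = 0 := fun t => by simp
  refine ⟨a, (hfin a (a + c)).toFinset, fun t => ?_, ?_⟩
  · rw [hmem]
    constructor
    · rintro ⟨h1, h2⟩
      exact ⟨⟨h1.1, lt_of_le_of_ne h1.2 (by rintro rfl; exact hb h2)⟩, h2⟩
    · rintro ⟨h1, h2⟩
      exact ⟨Ico_subset_Icc_self h1, h2⟩
  · rw [even_card_zeros_iff (by linarith) _ f hf ha hb hmem
      (fun t ht => hd t ((hmem t).1 ht).2), hper a]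
    exact mul_self_pos.2 ha

end

/-! ### Characters of the orthogonal group -/

section

open Submodule

theorem Submodule.reflection_congr {F : Type*} [NormedAddCommGroup F] [InnerProductSpace ℝ F]
    {K K' : Submodule ℝ F} [K.HasOrthogonalProjection] [K'.HasOrthogonalProjection] (h : K = K') :
    K.reflection = K'.reflection := by
  subst h; rfl

/-- Any two reflections in hyperplanes are conjugate in the orthogonal group, so a multiplicative
function to a commutative monoid takes the same value on all of them. -/
theorem map_reflection_eq_map_reflection {F M : Type*} [NormedAddCommGroup F]
    [InnerProductSpace ℝ F] [FiniteDimensional ℝ F] [CommMonoid M] (χ : (F ≃ₗᵢ[ℝ] F) →* M)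
    {u v : F} (hu : u ≠ 0) (hv : v ≠ 0) :
    χ ((ℝ ∙ u)ᗮ.reflection) = χ ((ℝ ∙ v)ᗮ.reflection) := by
  -- Rescaling `v` to the length of `u` leaves its hyperplane unchanged and makes the reflection in
  -- the hyperplane orthogonal to `u - w` carry `u` to `w`; this reflection conjugates the two given
  -- ones.
  set w : F := (‖u‖ / ‖v‖) • v with hw
  have hv' : ‖v‖ ≠ 0 := norm_ne_zero_iff.2 hv
  have hnw : ‖w‖ = ‖u‖ := by
    rw [hw, norm_smul, Real.norm_of_nonneg (by positivity)]
    field_simp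
  have hspan : (ℝ ∙ w) = (ℝ ∙ v) := by
    rw [hw]
    exact span_singleton_smul_eq (isUnit_iff_ne_zero.2 (div_ne_zero (norm_ne_zero_iff.2 hu) hv')) v
  set ρ : F ≃ₗᵢ[ℝ] F := (ℝ ∙ (u - w))ᗮ.reflection with hρ
  have hρu : ρ u = w := reflection_sub hnw.symm
  have hρρ : ρ * ρ = 1 := reflection_mul_reflection _
  have hmap : (ℝ ∙ v)ᗮ = ((ℝ ∙ u)ᗮ).map (ρ.toLinearEquiv : F →ₗ[ℝ] F) := by
    rw [Submodule.map_orthogonal_equiv (ℝ ∙ u) ρ, Submodule.map_span, Set.image_singleton, ← hspan]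
    congr 2
    simp [hρu]
  have hconj : (ℝ ∙ v)ᗮ.reflection = ρ * (ℝ ∙ u)ᗮ.reflection * ρ := by
    rw [reflection_congr hmap, reflection_map]
    have hs : ρ.symm = ρ := by rw [hρ, reflection_symm]
    rw [hs]
    rfl
  rw [hconj, map_mul, map_mul, mul_right_comm, ← map_mul, hρρ, map_one, one_mul]

/-- A multiplicative function on the orthogonal group with values in a commutative monoid takes
on a product of reflections the corresponding power of its value on any one of them. -/
theorem map_prod_reflection {F M : Type*} [NormedAddCommGroup F]
    [InnerProductSpace ℝ F] [FiniteDimensional ℝ F] [CommMonoid M] (χ : (F ≃ₗᵢ[ℝ] F) →* M)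
    {u : F} (hu : u ≠ 0) (l : List F) (hl : ∀ v ∈ l, v ≠ 0) :
    χ ((l.map fun v => (ℝ ∙ v)ᗮ.reflection).prod) = χ ((ℝ ∙ u)ᗮ.reflection) ^ l.length := by
  induction l with
  | nil => simp
  | cons v l ih =>
    rw [List.map_cons, List.prod_cons, map_mul, ih fun w hw => hl w (List.mem_cons_of_mem _ hw),
      map_reflection_eq_map_reflection χ (hl v List.mem_cons_self) hu, List.length_cons, pow_succ']

/-- A multiplicative function on the orthogonal group with values in a commutative monoid is
trivial on rotations. -/
theorem map_eq_one_of_det_eq_one {F M : Type*} [NormedAddCommGroup F]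
    [InnerProductSpace ℝ F] [FiniteDimensional ℝ F] [CommMonoid M] (χ : (F ≃ₗᵢ[ℝ] F) →* M)
    (g : F ≃ₗᵢ[ℝ] F) (hg : LinearMap.det (g.toLinearEquiv : F →ₗ[ℝ] F) = 1) : χ g = 1 := by
  classical
  obtain ⟨l₀, -, hl₀⟩ := g.reflections_generate_dim
  -- The factorization into reflections may contain zero vectors, which contribute the identity.
  -- They are removed so that every factor has determinant -1.
  have hzero : ∀ l : List F, (l.map fun v => (ℝ ∙ v)ᗮ.reflection).prod =
      ((l.filter (fun v => v ≠ 0)).map fun v => (ℝ ∙ v)ᗮ.reflection).prod := by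
    intro l
    induction l with
    | nil => rfl
    | cons v l ih =>
      rw [List.map_cons, List.prod_cons, ih]
      by_cases hv : v = 0
      · have h0 : (ℝ ∙ v)ᗮ.reflection = 1 := by
          refine LinearIsometryEquiv.ext fun x => reflection_mem_subspace_eq_self ?_
          simp [hv]
        rw [h0, one_mul, List.filter_cons_of_neg (by simpa using hv)]
      · rw [List.filter_cons_of_pos (by simpa using hv), List.map_cons, List.prod_cons]
  obtain ⟨l, hl, hne⟩ : ∃ l : List F,
      g = (l.map fun v => (ℝ ∙ v)ᗮ.reflection).prod ∧ ∀ v ∈ l, v ≠ 0 :=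
    ⟨_, hl₀.trans (hzero l₀), fun v hv => by simpa using (List.mem_filter.1 hv).2⟩
  rcases l with _ | ⟨u, l'⟩
  · rw [hl]; simp
  have hu : u ≠ 0 := hne u List.mem_cons_self
  let δ : (F ≃ₗᵢ[ℝ] F) →* ℝ :=
    { toFun := fun g => LinearMap.det (g.toLinearEquiv : F →ₗ[ℝ] F)
      map_one' := LinearMap.det_id
      map_mul' := fun g h => LinearMap.det_comp _ _ }
  have hδρ : δ ((ℝ ∙ u)ᗮ.reflection) = -1 := by
    have := Submodule.det_reflection (ℝ ∙ u)ᗮ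
    rw [orthogonal_orthogonal, finrank_span_singleton hu, pow_one] at this
    exact this
  have h1 : δ g = 1 := hg
  rw [hl, map_prod_reflection δ hu _ hne, hδρ, neg_one_pow_eq_one_iff_even (by norm_num)] at h1
  obtain ⟨k, hk⟩ := h1
  -- The number of reflections is even, and `χ` of a reflection squares to 1.
  rw [hl, map_prod_reflection χ hu _ hne, hk, pow_add, ← mul_pow, ← map_mul,
    reflection_mul_reflection, map_one, one_pow]

end

/-! ### The generalized cross product -/

section

open Module

/-- A generalized cross product: a vector field `W` in the kernel of a family of linear maps `L q`
whose target has one dimension less than the source. It depends smoothly on `q`, does not vanish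
where `L q` is surjective, and is natural up to a determinant factor. -/
theorem exists_cross_product {E F : Type*} [NormedAddCommGroup E] [NormedSpace ℝ E]
    [FiniteDimensional ℝ E] [AddCommGroup F] [Module ℝ F] [FiniteDimensional ℝ F]
    (hdim : finrank ℝ E = finrank ℝ F + 1) (L : E → E →ₗ[ℝ] F)
    (hL : ∀ (ξ : F →ₗ[ℝ] ℝ) (u : E), ContDiff ℝ 1 fun q => ξ (L q u)) :
    ∃ W : E → E, ContDiff ℝ 1 W ∧ (∀ q, L q (W q) = 0) ∧
      (∀ q, Function.Surjective (L q) → W q ≠ 0) ∧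
      ∀ (g h : E →ₗ[ℝ] E) (B : F →ₗ[ℝ] F) (q q' : E), g ∘ₗ h = LinearMap.id →
        L q' ∘ₗ g = B ∘ₗ L q → W q' = (LinearMap.det B * LinearMap.det h) • g (W q) := by
  classical
  set n := finrank ℝ F
  let b : Basis (Fin (n + 1)) ℝ E := finBasisOfFinrankEq ℝ E hdim
  let c : Basis (Fin n) ℝ F := finBasis ℝ F
  -- `J` turns `(ζ, L q) : E → ℝ × F` into an endomorphism of `E`, so that its determinant makes
  -- sense and is multiplicative.
  let J : (ℝ × F) ≃ₗ[ℝ] E := ((LinearEquiv.refl ℝ ℝ).prodCongr c.equivFun) ≪≫ₗ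
    Fin.consLinearEquiv ℝ (fun _ : Fin n.succ => ℝ) ≪≫ₗ b.equivFun.symm
  let M : E → (E →ₗ[ℝ] ℝ) → Matrix (Fin n.succ) (Fin n.succ) ℝ := fun q ζ =>
    Matrix.of fun i j => Fin.cons (α := fun _ => ℝ) (ζ (b j)) (fun k => c.coord k (L q (b j))) i
  have hMT : ∀ q ζ, (M q ζ).det = LinearMap.det (J.toLinearMap ∘ₗ ζ.prod (L q)) := by
    intro q ζ
    rw [← LinearMap.det_toMatrix b]
    congr 1
    ext i j
    rw [LinearMap.toMatrix_apply]
    have h1 : b.repr ((J.toLinearMap ∘ₗ ζ.prod (L q)) (b j)) =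
        b.repr (b.equivFun.symm (Fin.cons (ζ (b j)) (c.equivFun (L q (b j))))) := rfl
    have h2 : ∀ y : Fin (n + 1) → ℝ, b.repr (b.equivFun.symm y) i = y i := fun y =>
      congrFun (b.equivFun.apply_symm_apply y) i
    rw [h1, h2]
    refine Fin.cases ?_ (fun k => ?_) i <;> simp [M]
  -- The cofactors along the first row: `W q` is the vector with `ζ (W q) = det (ζ, L q)` for every
  -- functional `ζ`. All its properties follow from this characterization; for instance, taking a
  -- row of `L q` as `ζ` repeats a row.
  let W : E → E := fun q =>
    ∑ j : Fin n.succ, ((-1) ^ (j : ℕ) * ((M q 0).submatrix Fin.succ j.succAbove).det) • b j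
  have hsub : ∀ q ζ (j : Fin n.succ), (M q ζ).submatrix Fin.succ j.succAbove =
      (M q 0).submatrix Fin.succ j.succAbove := by
    intro q ζ j
    ext i k
    simp [M]
  have hW : ∀ q (ζ : E →ₗ[ℝ] ℝ), ζ (W q) = (M q ζ).det := by
    intro q ζ
    rw [Matrix.det_succ_row_zero, map_sum]
    refine Finset.sum_congr rfl fun j _ => ?_
    rw [hsub q ζ j, map_smul, smul_eq_mul]
    simp only [M, Matrix.of_apply, Fin.cons_zero]
    ring
  refine ⟨W, ?_, ?_, ?_, ?_⟩
  · refine ContDiff.sum fun j _ => ContDiff.smul (contDiff_const.mul ?_) contDiff_const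
    simp only [Matrix.det_apply]
    refine ContDiff.sum fun σ _ => ContDiff.const_smul _ (contDiff_prod fun i _ => ?_)
    simpa [M] using hL (c.coord (σ i)) (b (j.succAbove i))
  · intro q
    refine c.ext_elem fun k => ?_
    have h1 := hW q (c.coord k ∘ₗ L q)
    rw [Matrix.det_zero_of_row_eq (Fin.succ_ne_zero k).symm] at h1
    · simpa using h1
    · ext j
      simp [M]
  · intro q hq h0
    have hker : finrank ℝ (LinearMap.ker (L q)) = 1 := by
      have := (L q).finrank_range_add_finrank_ker
      rw [LinearMap.range_eq_top.2 hq, finrank_top, hdim] at this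
      omega
    obtain ⟨⟨w, hw⟩, hw0, hspan⟩ := finrank_eq_one_iff'.1 hker
    have hw0' : w ≠ 0 := fun h => hw0 (Subtype.ext h)
    -- With `ζ` nonzero on the kernel line of `L q`, the map `(ζ, L q)` is injective, so its
    -- determinant `ζ (W q)` is nonzero.
    obtain ⟨ζ, hζ⟩ : ∃ ζ : Dual ℝ E, ζ w ≠ 0 := by
      by_contra! h
      exact hw0' ((Module.forall_dual_apply_eq_zero_iff ℝ w).1 h)
    have hdet := hW q ζ
    rw [h0, map_zero, hMT, eq_comm, LinearMap.det_eq_zero_iff_ker_ne_bot] at hdet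
    refine hdet (LinearMap.ker_eq_bot'.2 fun x hx => ?_)
    have hx' : ζ x = 0 ∧ L q x = 0 := by simpa using hx
    obtain ⟨r, hr⟩ := hspan ⟨x, hx'.2⟩
    have hr' : r • w = x := congrArg Subtype.val hr
    have : r * ζ w = 0 := by rw [← smul_eq_mul, ← map_smul, hr', hx'.1]
    rw [← hr', (mul_eq_zero.1 this).resolve_right hζ, zero_smul]
  · intro g h B q q' hgh hLB
    have hhg : h ∘ₗ g = LinearMap.id := (LinearMap.comp_eq_id_comm _ _).1 hgh
    have hL' : L q' = B ∘ₗ L q ∘ₗ h := by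
      rw [← LinearMap.comp_assoc, ← hLB, LinearMap.comp_assoc, hgh, LinearMap.comp_id]
    rw [← sub_eq_zero]
    refine (Module.forall_dual_apply_eq_zero_iff ℝ _).1 fun ζ => ?_
    rw [map_sub, map_smul, sub_eq_zero, hW, smul_eq_mul]
    change _ = _ * (ζ ∘ₗ g) (W q)
    rw [hW, hMT, hMT]
    have hcomp : J.toLinearMap ∘ₗ ζ.prod (L q') =
        (J.toLinearMap ∘ₗ (LinearMap.prodMap LinearMap.id B) ∘ₗ J.symm.toLinearMap) ∘ₗ
          (J.toLinearMap ∘ₗ (ζ ∘ₗ g).prod (L q)) ∘ₗ h := by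
      ext x
      have := LinearMap.congr_fun hgh x
      simp only [LinearMap.comp_apply, LinearMap.id_apply] at this
      simp [hL', this]
    rw [hcomp, LinearMap.det_comp, LinearMap.det_comp, LinearMap.det_conj, LinearMap.det_prodMap,
      LinearMap.det_id]
    ring

end

/-! ### Skew maps and rotations -/

section

open Module Filter Topology NormedSpace

/-- The skew-symmetric endomorphisms of a Euclidean space. -/
def skewMaps (F : Type*) [NormedAddCommGroup F] [InnerProductSpace ℝ F] :
    Submodule ℝ (F →L[ℝ] F) where
  carrier := {A | ∀ x y, inner ℝ (A x) y = -inner ℝ x (A y)}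
  add_mem' := fun {A B} hA hB x y => by
    simp only [add_apply, inner_add_left, inner_add_right, hA x y, hB x y]; ring
  zero_mem' := fun x y => by simp
  smul_mem' := fun c A hA x y => by
    simp only [smul_apply, inner_smul_left, inner_smul_right, hA x y]; simp

theorem inner_skewMaps_self {F : Type*} [NormedAddCommGroup F] [InnerProductSpace ℝ F]
    {A : F →L[ℝ] F} (hA : A ∈ skewMaps F) (x : F) : inner ℝ (A x) x = 0 := by
  have := hA x x
  rw [real_inner_comm (A x) x] at this
  linarith

/-- The exponential of a skew-symmetric endomorphism is a rotation. -/
theorem exists_rotation_exp {F : Type*} [NormedAddCommGroup F] [InnerProductSpace ℝ F]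
    [FiniteDimensional ℝ F] {A : F →L[ℝ] F} (hA : A ∈ skewMaps F) :
    ∃ R : F ≃ₗᵢ[ℝ] F, LinearMap.det (R.toLinearEquiv : F →ₗ[ℝ] F) = 1 ∧
      ∀ x, R x = exp A x := by
  have : CompleteSpace F := FiniteDimensional.complete ℝ F
  let _ : NormedAlgebra ℚ (F →L[ℝ] F) := NormedAlgebra.restrictScalars ℚ ℝ _
  have key : ∀ B ∈ skewMaps F, ∃ R : F ≃ₗᵢ[ℝ] F, ∀ x, R x = exp B x := by
    intro B hB
    have hskew : B ∈ skewAdjoint (F →L[ℝ] F) := by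
      rw [skewAdjoint.mem_iff]
      ext x
      refine ext_inner_right ℝ fun y => ?_
      rw [ContinuousLinearMap.star_eq_adjoint, ContinuousLinearMap.adjoint_inner_left,
        neg_apply, inner_neg_left, hB x y, neg_neg]
    exact ⟨Unitary.linearIsometryEquiv ⟨exp B, exp_mem_unitary_of_mem_skewAdjoint hskew⟩,
      fun x => rfl⟩
  obtain ⟨S, hS⟩ := key ((1 / 2 : ℝ) • A) ((skewMaps F).smul_mem _ hA)
  -- As a square of an isometry, whose determinant is ±1, `exp A` has determinant 1.
  have hsq : exp A = exp ((1 / 2 : ℝ) • A) * exp ((1 / 2 : ℝ) • A) := by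
    rw [← exp_add_of_commute (Commute.refl _), ← add_smul]
    norm_num
  refine ⟨S * S, ?_, fun x => ?_⟩
  · have h1 : (LinearMap.det (S.toLinearEquiv : F →ₗ[ℝ] F)) ^ 2 = 1 := by
      have := S.toLinearIsometry.normDet_eq_one
      rw [LinearMap.normDet_eq_abs_det] at this
      rw [← sq_abs]
      exact (congrArg (· ^ 2) this).trans (one_pow 2)
    rw [← h1, sq]
    exact LinearMap.det_comp _ _
  · rw [hsq]
    simp [hS]

end

/-! ### Rigidity map and momentum -/

section

open Module

/-- The symmetric function `vw ↦ ⟪q v - q w, u v - u w⟫` on pairs of vertices. -/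
noncomputable def pairStretch {V : Type*} {d : ℕ} (q u : Placement V d) : Sym2 V → ℝ :=
  Sym2.lift ⟨fun v w => inner ℝ (q v - q w) (u v - u w), fun v w => by
    change inner ℝ (q v - q w) (u v - u w) = inner ℝ (q w - q v) (u w - u v)
    rw [← neg_sub (q w) (q v), ← neg_sub (u w) (u v), inner_neg_neg]⟩

@[simp]
theorem pairStretch_mk {V : Type*} {d : ℕ} (q u : Placement V d) (v w : V) :
    pairStretch q u s(v, w) = inner ℝ (q v - q w) (u v - u w) := rfl

/-- The rigidity map of the framework `(Γ, q)`. -/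
noncomputable def rigidityMap {V : Type*} {d : ℕ} (Γ : SimpleGraph V) (q : Placement V d) :
    Placement V d →ₗ[ℝ] (Γ.edgeSet → ℝ) where
  toFun u e := pairStretch q u e
  map_add' u w := by
    ext ⟨e, he⟩
    induction e using Sym2.ind with
    | _ x y =>
      simp only [pairStretch_mk, Pi.add_apply, ← inner_add_right]
      congr 1; abel
  map_smul' c u := by
    ext ⟨e, he⟩
    induction e using Sym2.ind with
    | _ x y =>
      simp only [pairStretch_mk, Pi.smul_apply, RingHom.id_apply, ← smul_sub, inner_smul_right,
        smul_eq_mul]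

theorem rigidityMap_eq_iff {V : Type*} {d : ℕ} (Γ : SimpleGraph V) (q u q' u' : Placement V d) :
    rigidityMap Γ q u = rigidityMap Γ q' u' ↔ ∀ v w, Γ.Adj v w →
      (inner ℝ (q v - q w) (u v - u w) : ℝ) = inner ℝ (q' v - q' w) (u' v - u' w) := by
  constructor
  · intro h v w hvw
    exact congrFun h ⟨s(v, w), hvw⟩
  · intro h
    ext ⟨e, he⟩
    induction e using Sym2.ind with
    | _ x y => exact h x y he

theorem mem_ker_rigidityMap {V : Type*} {d : ℕ} {Γ : SimpleGraph V} {q u : Placement V d} :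
    u ∈ LinearMap.ker (rigidityMap Γ q) ↔ IsInfinitesimalMotion Γ q u := by
  rw [LinearMap.mem_ker, ← map_zero (rigidityMap Γ q), rigidityMap_eq_iff]
  simp [IsInfinitesimalMotion]

/-- By this symmetry the rigidity map is linear in the placement too, which gives its smooth
dependence on `q`. -/
theorem rigidityMap_comm {V : Type*} {d : ℕ} (Γ : SimpleGraph V) (q u : Placement V d) :
    rigidityMap Γ q u = rigidityMap Γ u q :=
  (rigidityMap_eq_iff Γ q u u q).2 fun _ _ _ => real_inner_comm _ _

/-- The parameter space of infinitesimal rigid motions of Euclidean space. -/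
abbrev RigidVelocity (d : ℕ) : Type :=
  skewMaps (EuclideanSpace ℝ (Fin d)) × EuclideanSpace ℝ (Fin d)

/-- The velocities of the vertices under an infinitesimal rigid motion. -/
noncomputable def rigidVelocity {V : Type*} {d : ℕ} (q : Placement V d) :
    RigidVelocity d →ₗ[ℝ] Placement V d where
  toFun z v := z.1.1 (q v) + z.2
  map_add' z z' := by ext1 v; simp; abel
  map_smul' c z := by ext1 v; simp

theorem rigidVelocity_apply {V : Type*} {d : ℕ} (q : Placement V d) (z : RigidVelocity d) (v : V) :
    rigidVelocity q z v = z.1.1 (q v) + z.2 := rfl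

theorem inner_rigidVelocity_sub {V : Type*} {d : ℕ} (q : Placement V d) (z : RigidVelocity d)
    (v w : V) :
    inner ℝ (q v - q w) (rigidVelocity q z v - rigidVelocity q z w) = 0 := by
  rw [rigidVelocity_apply, rigidVelocity_apply, add_sub_add_right_eq_sub, ← map_sub,
    real_inner_comm, inner_skewMaps_self z.1.2]

theorem rigidVelocity_mem_ker {V : Type*} {d : ℕ} (Γ : SimpleGraph V) (q : Placement V d)
    (z : RigidVelocity d) : rigidVelocity q z ∈ LinearMap.ker (rigidityMap Γ q) :=
  mem_ker_rigidityMap.2 fun v w _ => inner_rigidVelocity_sub q z v w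

theorem isTrivialInfinitesimalMotion_iff {V : Type*} {d : ℕ} (q u : Placement V d) :
    IsTrivialInfinitesimalMotion q u ↔ u ∈ LinearMap.range (rigidVelocity q) := by
  constructor
  · rintro ⟨A, t, hA, h⟩
    exact ⟨(⟨LinearMap.toContinuousLinearMap A, hA⟩, t), funext fun v => (h v).symm⟩
  · rintro ⟨z, rfl⟩
    exact ⟨z.1.1, z.2, z.1.2, fun v => rfl⟩

/-- The Euclidean inner product of velocity assignments. -/
noncomputable def placementInner {V : Type*} [Fintype V] {d : ℕ} :
    Placement V d →ₗ[ℝ] Placement V d →ₗ[ℝ] ℝ :=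
  LinearMap.mk₂ ℝ (fun u w => ∑ v, inner ℝ (u v) (w v))
    (fun u u' w => by simp [inner_add_left, Finset.sum_add_distrib])
    (fun c u w => by simp [inner_smul_left, Finset.mul_sum])
    (fun u w w' => by simp [inner_add_right, Finset.sum_add_distrib])
    (fun c u w => by simp [inner_smul_right, Finset.mul_sum])

theorem placementInner_apply {V : Type*} [Fintype V] {d : ℕ} (u w : Placement V d) :
    placementInner u w = ∑ v, inner ℝ (u v) (w v) := rfl

theorem placementInner_self_eq_zero {V : Type*} [Fintype V] {d : ℕ} {u : Placement V d}
    (h : placementInner u u = 0) : u = 0 := by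
  rw [placementInner_apply, Finset.sum_eq_zero_iff_of_nonneg
    fun v _ => real_inner_self_nonneg] at h
  exact funext fun v => inner_self_eq_zero.1 (h v (Finset.mem_univ v))

/-- The momentum of a velocity assignment: its pairings with all infinitesimal rigid motions. -/
noncomputable def momentMap {V : Type*} [Fintype V] {d : ℕ} (q : Placement V d) :
    Placement V d →ₗ[ℝ] Dual ℝ (RigidVelocity d) :=
  (rigidVelocity q).dualMap ∘ₗ placementInner.flip

theorem momentMap_apply {V : Type*} [Fintype V] {d : ℕ} (q u : Placement V d)
    (z : RigidVelocity d) : momentMap q u z = placementInner (rigidVelocity q z) u := rfl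

/-- The rigidity map together with the momentum map. -/
noncomputable def constraintMap {V : Type*} [Fintype V] {d : ℕ} (Γ : SimpleGraph V)
    (q : Placement V d) :
    Placement V d →ₗ[ℝ] (Γ.edgeSet → ℝ) × Dual ℝ (RigidVelocity d) :=
  (rigidityMap Γ q).prod (momentMap q)

theorem constraintMap_eq_zero_iff {V : Type*} [Fintype V] {d : ℕ} {Γ : SimpleGraph V}
    {q u : Placement V d} :
    constraintMap Γ q u = 0 ↔ rigidityMap Γ q u = 0 ∧ momentMap q u = 0 := Prod.mk_eq_zero

/-- If the infinitesimal rigid motions act faithfully on `q`, every momentum is realised by a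
unique trivial motion. -/
theorem momentMap_comp_rigidVelocity_bijective {V : Type*} [Fintype V] {d : ℕ}
    {q : Placement V d} (hq : Function.Injective (rigidVelocity q)) :
    Function.Bijective (momentMap q ∘ₗ rigidVelocity q) := by
  have hinj : Function.Injective (momentMap q ∘ₗ rigidVelocity q) := by
    rw [← LinearMap.ker_eq_bot, LinearMap.ker_eq_bot']
    intro z hz
    have h1 : momentMap q (rigidVelocity q z) z = 0 := by
      rw [← LinearMap.comp_apply, hz]; rfl
    have h2 := placementInner_self_eq_zero h1
    exact hq (by rw [h2, map_zero])
  exact ⟨hinj, (LinearMap.injective_iff_surjective_of_finrank_eq_finrank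
    Subspace.dual_finrank_eq.symm).1 hinj⟩

/-- A trivial motion corrects the momentum to any prescribed value without changing the edge
stretches. -/
theorem constraintMap_surjective {V : Type*} [Fintype V] {d : ℕ} {Γ : SimpleGraph V}
    {q : Placement V d} (hq : Function.Injective (rigidVelocity q))
    (hr : Function.Surjective (rigidityMap Γ q)) :
    Function.Surjective (constraintMap Γ q) := by
  rintro ⟨y, ℓ⟩
  obtain ⟨u, rfl⟩ := hr y
  obtain ⟨z, hz⟩ := (momentMap_comp_rigidVelocity_bijective hq).2 (ℓ - momentMap q u)
  refine ⟨u + rigidVelocity q z, Prod.ext ?_ ?_⟩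
  · change rigidityMap Γ q _ = _
    rw [map_add, LinearMap.mem_ker.1 (rigidVelocity_mem_ker Γ q z), add_zero]
  · change momentMap q _ = _
    rw [map_add, ← LinearMap.comp_apply, hz]
    abel

theorem Derivation.map_norm_sq {d : ℕ} (D : Derivation ℚ ℝ ℝ) (x : EuclideanSpace ℝ (Fin d)) :
    D (‖x‖ ^ 2) = 2 * inner ℝ x (WithLp.toLp 2 fun i => D (x i)) := by
  simp only [EuclideanSpace.real_norm_sq_eq, map_sum, PiLp.inner_apply, Finset.mul_sum]
  refine Finset.sum_congr rfl fun i _ => ?_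
  rw [D.leibniz_pow]
  simp
  ring

/-- At a generic placement the rank of the rigidity map is at most its rank at any placement with
the same edge lengths. -/
theorem rigidityMap_surjective_of_isGenericPlacement {V : Type*} {d : ℕ} {Γ : SimpleGraph V}
    {p q : Placement V d} (hgen : IsGenericPlacement p)
    (hq : ∀ v w, Γ.Adj v w → dist (q v) (q w) = dist (p v) (p w))
    (hp : Function.Surjective (rigidityMap Γ p)) : Function.Surjective (rigidityMap Γ q) := by
  intro y
  obtain ⟨u, rfl⟩ := hp y
  -- `D` is chosen with `D p = u`. Differentiating the equality of squared edge lengths shows that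
  -- the velocities `D q` stretch the edges at `q` as `u` does at `p`.
  obtain ⟨D, hD⟩ := hgen.exists_derivation fun i => u i.1 i.2
  refine ⟨fun v => WithLp.toLp 2 fun i => D (q v i), (rigidityMap_eq_iff _ _ _ _ _).2 ?_⟩
  intro v w hvw
  have h := congrArg (fun x => D (x ^ 2)) (hq v w hvw)
  simp only [dist_eq_norm, D.map_norm_sq] at h
  have h' := mul_left_cancel₀ two_ne_zero h
  convert h' using 2
  · ext i; simp
  · ext i; simp [← hD (v, i), ← hD (w, i)]

/-- The rigidity map of an isostatic framework is onto. -/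
theorem IsIsostatic.rigidityMap_surjective {V : Type*} [Fintype V] {d : ℕ} {G : SimpleGraph V}
    {p : Placement V d} (h : IsIsostatic G p) : Function.Surjective (rigidityMap G p) := by
  classical
  rw [← LinearMap.range_eq_top]
  by_contra hne
  -- `f` is a nonzero self-stress. If its coefficient on `e` is nonzero, a motion that preserves all
  -- other edges must preserve `e` as well, so `e` would be redundant.
  obtain ⟨f, hf0, hf⟩ := Submodule.exists_le_ker_of_lt_top _ (lt_top_iff_ne_top.2 hne)
  have hfu : ∀ u, f (rigidityMap G p u) = 0 := fun u => hf ⟨u, rfl⟩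
  obtain ⟨e, he⟩ : ∃ e : G.edgeSet, f (Pi.single e 1) ≠ 0 := by
    by_contra! hall
    refine hf0 (LinearMap.pi_ext' fun e => LinearMap.ext_ring ?_)
    simpa using hall e
  refine h.2 e e.2 fun u hu => h.1 u ?_
  rw [← mem_ker_rigidityMap, LinearMap.mem_ker]
  have hothers : ∀ e' : G.edgeSet, e' ≠ e → rigidityMap G p u e' = 0 := by
    rintro ⟨e', he'⟩ hne'
    induction e' using Sym2.ind with
    | _ x y =>
      refine hu x y ?_
      rw [SimpleGraph.deleteEdges_adj]
      exact ⟨he', fun h => hne' (Subtype.ext h)⟩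
  have hsingle : rigidityMap G p u = rigidityMap G p u e • Pi.single e (1 : ℝ) := by
    ext e'
    by_cases h : e' = e
    · subst h; simp
    · simp [h, hothers e' h]
  have h0 := hfu u
  rw [hsingle, map_smul, smul_eq_mul] at h0
  rw [hsingle, (mul_eq_zero.1 h0).resolve_right he, zero_smul]

end

/-! ### Codimension of the affine span -/

section

open Module

/-- The directions orthogonal to the affine span of a placement. -/
noncomputable def normalSpace {V : Type*} {d : ℕ} (q : Placement V d) :
    Submodule ℝ (EuclideanSpace ℝ (Fin d)) :=
  (Submodule.span ℝ (Set.range fun e : V × V => q e.1 - q e.2))ᗮ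

theorem mem_normalSpace {V : Type*} {d : ℕ} {q : Placement V d} {y : EuclideanSpace ℝ (Fin d)} :
    y ∈ normalSpace q ↔ ∀ v w, inner ℝ (q v - q w) y = 0 := by
  rw [normalSpace, Submodule.mem_orthogonal]
  constructor
  · intro h v w
    exact h _ (Submodule.subset_span ⟨(v, w), rfl⟩)
  · intro h x hx
    induction hx using Submodule.span_induction with
    | mem x hx => obtain ⟨e, rfl⟩ := hx; exact h _ _
    | zero => exact inner_zero_left _
    | add x y _ _ hx hy => rw [inner_add_left, hx, hy, add_zero]
    | smul c x _ hx => rw [inner_smul_left, hx, mul_zero]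

/-- If a skew map sends all edge directions into the normal space and kills the normal space, it
vanishes. -/
theorem skewMaps_eq_zero_of_normalSpace {V : Type*} {d : ℕ} {q : Placement V d}
    {A : EuclideanSpace ℝ (Fin d) →L[ℝ] EuclideanSpace ℝ (Fin d)}
    (hA : A ∈ skewMaps (EuclideanSpace ℝ (Fin d)))
    (h1 : ∀ v w, A (q v - q w) ∈ normalSpace q) (h2 : ∀ y ∈ normalSpace q, A y = 0) : A = 0 := by
  set U := Submodule.span ℝ (Set.range fun e : V × V => q e.1 - q e.2) with hU
  have hAU : ∀ x ∈ U, A x = 0 := by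
    intro x hx
    have hxN : A x ∈ Uᗮ := by
      induction hx using Submodule.span_induction with
      | mem x hx => obtain ⟨e, rfl⟩ := hx; exact h1 _ _
      | zero => rw [map_zero]; exact Submodule.zero_mem _
      | add x y _ _ hx hy => rw [map_add]; exact Submodule.add_mem _ hx hy
      | smul c x _ hx => rw [map_smul]; exact Submodule.smul_mem _ _ hx
    have h3 := hA x (A x)
    rw [h2 (A x) hxN, inner_zero_right, neg_zero] at h3
    exact inner_self_eq_zero.1 h3
  ext1 x
  obtain ⟨y, hy, z, hz, rfl⟩ := U.exists_add_mem_mem_orthogonal x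
  rw [map_add, hAU y hy, h2 z hz, add_zero]
  rfl

instance (d : ℕ) : FiniteDimensional ℝ (RigidVelocity d) := Module.Finite.prod

instance (d : ℕ) : Module.Free ℝ (RigidVelocity d) := Module.Free.of_divisionRing ℝ _

theorem LinearMap.finrank_le_finrank_range_add {M N P : Type*} [AddCommGroup M] [Module ℝ M]
    [FiniteDimensional ℝ M] [AddCommGroup N] [Module ℝ N] [AddCommGroup P] [Module ℝ P]
    [FiniteDimensional ℝ P] (f : M →ₗ[ℝ] N) (g : M →ₗ[ℝ] P)
    (h : ∀ x, f x = 0 → g x = 0 → x = 0) :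
    finrank ℝ M ≤ finrank ℝ (LinearMap.range f) + finrank ℝ P := by
  have hinj : Function.Injective (g ∘ₗ (LinearMap.ker f).subtype) := by
    rw [← LinearMap.ker_eq_bot, LinearMap.ker_eq_bot']
    rintro ⟨x, hx⟩ hgx
    exact Subtype.ext (h x hx hgx)
  have h1 := LinearMap.finrank_le_finrank_of_injective hinj
  have h2 := f.finrank_range_add_finrank_ker
  omega

/-- Velocities normal to the affine span are infinitesimal motions, so if the kernel of the
rigidity map is not much larger than the space of infinitesimal rigid motions, the affine span has
small codimension. -/
theorem finrank_normalSpace_le {V : Type*} [Fintype V] {d : ℕ} (hV : d + 1 ≤ Fintype.card V)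
    {Γ : SimpleGraph V} {q : Placement V d} {k : ℕ}
    (hk : finrank ℝ (LinearMap.ker (rigidityMap Γ q)) ≤ finrank ℝ (RigidVelocity d) + k) :
    finrank ℝ (normalSpace q) ≤ k := by
  have : Nonempty V := Fintype.card_pos_iff.1 (by omega)
  let v₀ : V := Classical.arbitrary V
  set N := normalSpace q
  set c := finrank ℝ N
  let b := stdOrthonormalBasis ℝ N
  let Φ : (RigidVelocity d × (V → N)) →ₗ[ℝ] Placement V d :=
    (rigidVelocity q).coprod (N.subtype.compLeft V)
  have hΦ : ∀ z ν v, Φ (z, ν) v = rigidVelocity q z v + ν v := fun z ν v => rfl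
  have hrange : LinearMap.range Φ ≤ LinearMap.ker (rigidityMap Γ q) := by
    rintro _ ⟨⟨z, ν⟩, rfl⟩
    rw [mem_ker_rigidityMap]
    intro v w _
    rw [hΦ, hΦ, add_sub_add_comm, inner_add_right, inner_rigidVelocity_sub, zero_add, inner_sub_right,
      mem_normalSpace.1 (ν v).2, mem_normalSpace.1 (ν w).2, sub_zero]
  -- `ψ` detects the kernel of `Φ`. Since `A (b i)` is orthogonal to `b i`, a single vector of `ℝ^d`
  -- records both `A (b i)` and the `b i`-component of the velocity at `v₀`; this keeps the target
  -- at dimension `d * c`, not `(d + 1) * c`.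
  let ψ : (RigidVelocity d × (V → N)) →ₗ[ℝ] (Fin c → EuclideanSpace ℝ (Fin d)) :=
    { toFun := fun x i => x.1.1.1 (b i) + inner ℝ (b i : EuclideanSpace ℝ (Fin d))
        (rigidVelocity q x.1 v₀) • (b i : EuclideanSpace ℝ (Fin d))
      map_add' := fun x y => by
        ext1 i
        simp only [Prod.fst_add, map_add, Submodule.coe_add, add_apply, Pi.add_apply,
          inner_add_right, add_smul]
        abel
      map_smul' := fun r x => by
        ext1 i
        simp only [Prod.smul_fst, map_smul, Submodule.coe_smul, smul_apply, Pi.smul_apply,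
          inner_smul_right, smul_add, RingHom.id_apply, mul_smul] }
  have hψ : ∀ x, Φ x = 0 → ψ x = 0 → x = 0 := by
    rintro ⟨⟨⟨A, hA⟩, t⟩, ν⟩ hx h0
    have hx' : ∀ v, A (q v) + t = -(ν v : EuclideanSpace ℝ (Fin d)) := fun v =>
      eq_neg_of_add_eq_zero_left (congrFun hx v)
    have h0' : ∀ i, A (b i) + inner ℝ (b i : EuclideanSpace ℝ (Fin d)) (A (q v₀) + t) •
        (b i : EuclideanSpace ℝ (Fin d)) = 0 := fun i => congrFun h0 i
    have hin : ∀ i, inner ℝ (b i : EuclideanSpace ℝ (Fin d)) (A (q v₀) + t) = 0 := by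
      intro i
      have h3 := congrArg (fun y => inner ℝ y (b i : EuclideanSpace ℝ (Fin d))) (h0' i)
      have hb : inner ℝ (b i : EuclideanSpace ℝ (Fin d)) (b i : EuclideanSpace ℝ (Fin d)) = 1 := by
        rw [real_inner_self_eq_norm_sq, ← Submodule.coe_norm, b.orthonormal.1 i, one_pow]
      simpa only [inner_add_left, inner_smul_left, inner_skewMaps_self hA, hb, inner_zero_left,
        zero_add, mul_one, conj_trivial] using h3
    have hAb : ∀ i, A (b i) = 0 := fun i => by
      have := h0' i
      rwa [hin i, zero_smul, add_zero] at this
    have hν₀ : ν v₀ = 0 := by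
      refine b.toBasis.ext_elem fun i => ?_
      have h4 := hin i
      rw [hx' v₀, inner_neg_right, neg_eq_zero] at h4
      rw [b.coe_toBasis_repr_apply, b.coe_toBasis_repr_apply, b.repr_apply_apply, map_zero]
      exact h4
    have hAN : ∀ y ∈ N, A y = 0 := by
      intro y hy
      have h5 : A.toLinearMap ∘ₗ N.subtype = 0 := b.toBasis.ext fun i => by simpa using hAb i
      exact LinearMap.congr_fun h5 ⟨y, hy⟩
    have hA0 : A = 0 := skewMaps_eq_zero_of_normalSpace hA (fun v w => by
      have h6 : A (q v - q w) = (ν w - ν v : N) := by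
        have h7 := hx' v
        have h8 := hx' w
        rw [map_sub, eq_sub_of_add_eq h7, eq_sub_of_add_eq h8]
        push_cast
        abel
      rw [h6]
      exact Submodule.coe_mem _) hAN
    have ht : t = 0 := by
      have := hx' v₀
      simpa [hA0, hν₀] using this
    have hν : ν = 0 := by
      ext1 v
      have := hx' v
      rw [hA0, ht] at this
      simpa using this
    subst hA0 ht hν
    rfl
  have h2 := Submodule.finrank_mono hrange
  have h3 := LinearMap.finrank_le_finrank_range_add Φ ψ hψ
  rw [finrank_prod, finrank_pi_fintype, finrank_pi_fintype] at h3
  simp only [finrank_euclideanSpace, Finset.sum_const, Finset.card_univ, Fintype.card_fin,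
    smul_eq_mul] at h3
  change _ + Fintype.card V * c ≤ _ at h3
  -- So far `card V * c ≤ d * c + k`; as `card V ≥ d + 1`, this leaves `c ≤ k`.
  have h4 : (d + 1) * c ≤ Fintype.card V * c := Nat.mul_le_mul_right c hV
  nlinarith

/-- The infinitesimal rigid motions act faithfully on placements whose affine span is at most a
hyperplane away from being full. -/
theorem rigidVelocity_injective {V : Type*} [Nonempty V] {d : ℕ} {q : Placement V d}
    (hq : finrank ℝ (normalSpace q) ≤ 1) : Function.Injective (rigidVelocity q) := by
  rw [← LinearMap.ker_eq_bot, LinearMap.ker_eq_bot']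
  rintro ⟨⟨A, hA⟩, t⟩ h
  have h' : ∀ v, A (q v) + t = 0 := fun v => congrFun h v
  have hU : ∀ v w, A (q v - q w) = 0 := fun v w => by
    rw [map_sub, eq_neg_of_add_eq_zero_left (h' v), eq_neg_of_add_eq_zero_left (h' w), sub_self]
  -- The normal space is at most a line, which `A` preserves; a skew map has no nonzero real
  -- eigenvalue, so `A` kills it.
  obtain ⟨⟨y, hy⟩, hspan⟩ := finrank_le_one_iff.1 hq
  have hAy : A y ∈ normalSpace q := by
    rw [mem_normalSpace]
    intro v w
    have := hA (q v - q w) y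
    rw [hU, inner_zero_left] at this
    linarith
  obtain ⟨r, hr⟩ := hspan ⟨A y, hAy⟩
  have hr' : r • y = A y := congrArg Subtype.val hr
  have hAy0 : A y = 0 := by
    have h1 := inner_skewMaps_self hA y
    rw [← hr', inner_smul_left] at h1
    rcases mul_eq_zero.1 h1 with h2 | h2
    · rw [← hr', show r = 0 by simpa using h2, zero_smul]
    · rw [inner_self_eq_zero.1 h2, map_zero]
  have hA0 : A = 0 := skewMaps_eq_zero_of_normalSpace hA
    (fun v w => by rw [hU]; exact Submodule.zero_mem _) (fun z hz => by
      obtain ⟨s, hs⟩ := hspan ⟨z, hz⟩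
      have hs' : s • y = z := congrArg Subtype.val hs
      rw [← hs', map_smul, hAy0, smul_zero])
  subst hA0
  have ht := h' (Classical.arbitrary V)
  rw [zero_apply, zero_add] at ht
  subst ht
  rfl

end

/-! ### Dimension counts and connectedness for isostatic frameworks -/

section

open Module

theorem finrank_edgeSet_fun {V : Type*} [Fintype V] (Γ : SimpleGraph V) :
    finrank ℝ (Γ.edgeSet → ℝ) = Nat.card Γ.edgeSet := by
  have := Fintype.ofFinite Γ.edgeSet
  rw [finrank_fintype_fun_eq_card, Nat.card_eq_fintype_card]

theorem finrank_ker_rigidityMap {V : Type*} [Fintype V] {d : ℕ} {Γ : SimpleGraph V}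
    {q : Placement V d} (h : Function.Surjective (rigidityMap Γ q)) :
    Nat.card Γ.edgeSet + finrank ℝ (LinearMap.ker (rigidityMap Γ q)) =
      finrank ℝ (Placement V d) := by
  rw [← (rigidityMap Γ q).finrank_range_add_finrank_ker, LinearMap.range_eq_top.2 h, finrank_top,
    finrank_edgeSet_fun]

theorem rigidityMap_surjective_mono {V : Type*} [Fintype V] {d : ℕ} {Γ Γ' : SimpleGraph V}
    (hΓ : Γ ≤ Γ') {q : Placement V d} (h : Function.Surjective (rigidityMap Γ' q)) :
    Function.Surjective (rigidityMap Γ q) := by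
  classical
  intro y
  obtain ⟨u, hu⟩ := h fun e => if he : e.1 ∈ Γ.edgeSet then y ⟨e.1, he⟩ else 0
  refine ⟨u, funext fun e => ?_⟩
  have := congrFun hu ⟨e.1, SimpleGraph.edgeSet_subset_edgeSet.2 hΓ e.2⟩
  rw [dif_pos e.2] at this
  exact this

theorem finrank_constraints {V : Type*} [Fintype V] {d : ℕ} (Γ : SimpleGraph V) :
    finrank ℝ ((Γ.edgeSet → ℝ) × Dual ℝ (RigidVelocity d)) =
      Nat.card Γ.edgeSet + finrank ℝ (RigidVelocity d) := by
  rw [finrank_prod, finrank_edgeSet_fun, Subspace.dual_finrank_eq]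

theorem IsIsostatic.ker_rigidityMap {V : Type*} {d : ℕ} {G : SimpleGraph V}
    {p : Placement V d} (h : IsIsostatic G p) :
    LinearMap.ker (rigidityMap G p) = LinearMap.range (rigidVelocity p) := by
  ext u
  rw [mem_ker_rigidityMap, ← isTrivialInfinitesimalMotion_iff]
  refine ⟨h.1 u, fun hu => ?_⟩
  obtain ⟨z, rfl⟩ := (isTrivialInfinitesimalMotion_iff p u).1 hu
  exact fun v w _ => inner_rigidVelocity_sub p z v w

theorem IsIsostatic.finrank_ker_le {V : Type*} {d : ℕ} {G : SimpleGraph V}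
    {p : Placement V d} (h : IsIsostatic G p) :
    finrank ℝ (LinearMap.ker (rigidityMap G p)) ≤ finrank ℝ (RigidVelocity d) := by
  rw [h.ker_rigidityMap]
  exact LinearMap.finrank_range_le _

namespace IsIsostatic

variable {V : Type*} [Fintype V] {d : ℕ} {G : SimpleGraph V} {p : Placement V d}

theorem normalSpace_eq_bot (h : IsIsostatic G p) (hV : d + 1 ≤ Fintype.card V) :
    normalSpace p = ⊥ := by
  have := finrank_normalSpace_le hV (Γ := G) (q := p) (k := 0) h.finrank_ker_le
  exact Submodule.finrank_eq_zero.1 (Nat.le_zero.1 this)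

/-- Maxwell's count: the affine span of `p` is full, so the trivial motions have full dimension, and
rank-nullity applies to the surjective rigidity map. -/
theorem finrank_placement (h : IsIsostatic G p) (hV : d + 1 ≤ Fintype.card V) :
    finrank ℝ (Placement V d) = Nat.card G.edgeSet + finrank ℝ (RigidVelocity d) := by
  have : Nonempty V := Fintype.card_pos_iff.1 (by omega)
  have hinj : Function.Injective (rigidVelocity p) := rigidVelocity_injective (by
    rw [h.normalSpace_eq_bot hV, finrank_bot]; exact zero_le_one)
  rw [← finrank_ker_rigidityMap h.rigidityMap_surjective, h.ker_rigidityMap,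
    LinearMap.finrank_range_of_inj hinj]

theorem card_edgeSet_deleteEdges {a b : V} (hab : G.Adj a b) :
    Nat.card (G.deleteEdges {s(a, b)}).edgeSet + 1 = Nat.card G.edgeSet := by
  rw [SimpleGraph.edgeSet_deleteEdges]
  exact Set.ncard_sdiff_singleton_add_one hab

theorem finrank_placement_deleteEdges (h : IsIsostatic G p) (hV : d + 1 ≤ Fintype.card V)
    {a b : V} (hab : G.Adj a b) : finrank ℝ (Placement V d) =
      finrank ℝ (((G.deleteEdges {s(a, b)}).edgeSet → ℝ) × Dual ℝ (RigidVelocity d)) + 1 := by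
  rw [h.finrank_placement hV, finrank_constraints, ← card_edgeSet_deleteEdges hab]
  ring

variable {q : Placement V d}

theorem rigidityMap_deleteEdges_surjective (h : IsIsostatic G p) (hgen : IsGenericPlacement p)
    {a b : V} (hq : ∀ v w, (G.deleteEdges {s(a, b)}).Adj v w → dist (q v) (q w) = dist (p v) (p w)) :
    Function.Surjective (rigidityMap (G.deleteEdges {s(a, b)}) q) :=
  rigidityMap_surjective_of_isGenericPlacement hgen hq
    (rigidityMap_surjective_mono (SimpleGraph.deleteEdges_le _) h.rigidityMap_surjective)

/-- By genericity the rigidity map of `G - ab` is still onto at `q`, so its kernel exceeds the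
dimension of the rigid motions by at most one. The affine span of `q` then has codimension at most
one, which suffices for faithfulness. -/
theorem rigidVelocity_injective (h : IsIsostatic G p) (hgen : IsGenericPlacement p)
    (hV : d + 1 ≤ Fintype.card V) {a b : V} (hab : G.Adj a b)
    (hq : ∀ v w, (G.deleteEdges {s(a, b)}).Adj v w → dist (q v) (q w) = dist (p v) (p w)) :
    Function.Injective (rigidVelocity q) := by
  have : Nonempty V := ⟨a⟩
  have h1 := finrank_ker_rigidityMap (h.rigidityMap_deleteEdges_surjective hgen hq)
  have h2 := card_edgeSet_deleteEdges hab
  have h3 := h.finrank_placement hV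
  exact _root_.rigidVelocity_injective (finrank_normalSpace_le hV
    (Γ := G.deleteEdges {s(a, b)}) (by omega))

theorem constraintMap_surjective (h : IsIsostatic G p) (hgen : IsGenericPlacement p)
    (hV : d + 1 ≤ Fintype.card V) {a b : V} (hab : G.Adj a b)
    (hq : ∀ v w, (G.deleteEdges {s(a, b)}).Adj v w → dist (q v) (q w) = dist (p v) (p w)) :
    Function.Surjective (constraintMap (G.deleteEdges {s(a, b)}) q) :=
  _root_.constraintMap_surjective (h.rigidVelocity_injective hgen hV hab hq)
    (h.rigidityMap_deleteEdges_surjective hgen hq)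

/-- With all edges of `G` present the constraint map goes between spaces of equal dimension and is
onto by genericity. This is what makes the zeros of the length function simple. -/
theorem constraintMap_injective (h : IsIsostatic G p) (hgen : IsGenericPlacement p)
    (hV : d + 1 ≤ Fintype.card V) {a b : V} (hab : G.Adj a b)
    (hq : ∀ v w, G.Adj v w → dist (q v) (q w) = dist (p v) (p w)) :
    Function.Injective (constraintMap G q) := by
  have hsurj : Function.Surjective (constraintMap G q) :=
    _root_.constraintMap_surjective (h.rigidVelocity_injective hgen hV hab
      fun v w hvw => hq v w (SimpleGraph.deleteEdges_le _ hvw))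
      (rigidityMap_surjective_of_isGenericPlacement hgen hq h.rigidityMap_surjective)
  exact (LinearMap.injective_iff_surjective_of_finrank_eq_finrank
    (by rw [h.finrank_placement hV, finrank_constraints])).2 hsurj

/-- Deleting an edge from an isostatic graph in dimension at least two does not disconnect it. -/
theorem preconnected_deleteEdges (h : IsIsostatic G p) (hd : 2 ≤ d) (hV : d + 1 ≤ Fintype.card V)
    (a b : V) : (G.deleteEdges {s(a, b)}).Preconnected := by
  classical
  by_contra hcon
  simp only [SimpleGraph.Preconnected, not_forall] at hcon
  obtain ⟨x, y, hxy⟩ := hcon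
  set H := G.deleteEdges {s(a, b)}
  -- Here `d ≥ 2` is needed. Moving one component of `G - ab` with velocity `t` preserves `ab` to
  -- first order, hence is a trivial motion; this forces `t` to be normal to the full affine span of
  -- `p`.
  obtain ⟨t, ht0, ht⟩ : ∃ t : EuclideanSpace ℝ (Fin d), t ≠ 0 ∧ inner ℝ (p a - p b) t = 0 := by
    have h1 : 0 < finrank ℝ (ℝ ∙ (p a - p b))ᗮ := by
      have h2 := (ℝ ∙ (p a - p b)).finrank_add_finrank_orthogonal
      have h3 := finrank_span_le_card (R := ℝ) ({p a - p b} : Set (EuclideanSpace ℝ (Fin d)))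
      rw [finrank_euclideanSpace_fin] at h2
      simp only [Set.toFinset_singleton, Finset.card_singleton] at h3
      omega
    have := nontrivial_of_finrank_pos h1
    obtain ⟨⟨t, ht⟩, hne⟩ := exists_ne (0 : (ℝ ∙ (p a - p b))ᗮ)
    exact ⟨t, fun h0 => hne (Subtype.ext h0),
      Submodule.mem_orthogonal_singleton_iff_inner_right.1 ht⟩
  let u : Placement V d := fun v => if H.Reachable x v then t else 0
  have hu : IsInfinitesimalMotion G p u := by
    intro v w hvw
    by_cases he : s(v, w) = s(a, b)
    · have hz : ∀ v w, inner ℝ (p v - p w) t = 0 → inner ℝ (p v - p w) (u v - u w) = 0 := by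
        intro v w h0
        by_cases hv : H.Reachable x v <;> by_cases hw : H.Reachable x w <;>
          simp only [u, hv, hw, if_true, if_false, sub_self, sub_zero, zero_sub, inner_neg_right,
            h0, neg_zero, inner_zero_right]
      rcases Sym2.eq_iff.1 he with ⟨rfl, rfl⟩ | ⟨rfl, rfl⟩
      · exact hz _ _ ht
      · refine hz _ _ ?_
        rw [← neg_sub, inner_neg_left, ht, neg_zero]
    · have hadj : H.Adj v w := by
        rw [SimpleGraph.deleteEdges_adj]
        exact ⟨hvw, he⟩
      have hiff : H.Reachable x v ↔ H.Reachable x w :=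
        ⟨fun h => h.trans hadj.reachable, fun h => h.trans hadj.symm.reachable⟩
      have : u v = u w := by simp only [u, hiff]
      rw [this, sub_self, inner_zero_right]
  obtain ⟨z, hz⟩ := (isTrivialInfinitesimalMotion_iff p u).1 (h.1 u hu)
  have hall : ∀ v w, inner ℝ (p v - p w) (u v - u w) = 0 := fun v w => by
    rw [← hz]; exact inner_rigidVelocity_sub p z v w
  have hcross : ∀ v w, H.Reachable x v → ¬ H.Reachable x w → inner ℝ (p v - p w) t = 0 := by
    intro v w hv hw
    have := hall v w
    simpa only [u, hv, hw, if_true, if_false, sub_zero] using this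
  have hx : H.Reachable x x := SimpleGraph.Reachable.refl x
  have hxall : ∀ v, inner ℝ (p v - p x) t = 0 := by
    intro v
    by_cases hv : H.Reachable x v
    · rw [← sub_sub_sub_cancel_right (p v) (p x) (p y), inner_sub_left, hcross v y hv hxy,
        hcross x y hx hxy, sub_zero]
    · rw [← neg_sub, inner_neg_left, hcross x v hx hv, neg_zero]
  have htN : t ∈ normalSpace p := mem_normalSpace.2 fun v w => by
    rw [← sub_sub_sub_cancel_right (p v) (p w) (p x), inner_sub_left, hxall, hxall, sub_zero]
  rw [h.normalSpace_eq_bot hV] at htN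
  exact ht0 ((Submodule.mem_bot ℝ).1 htN)

end IsIsostatic

/-- In a connected graph the edge lengths bound all distances between vertices. -/
theorem exists_dist_le_of_reachable {V X : Type*} [PseudoMetricSpace X]
    {Γ : SimpleGraph V} (p : V → X) {v w : V} (h : Γ.Reachable v w) :
    ∃ B : ℝ, ∀ q : V → X, (∀ x y, Γ.Adj x y → dist (q x) (q y) = dist (p x) (p y)) →
      dist (q v) (q w) ≤ B := by
  obtain ⟨c⟩ := h
  induction c with
  | nil => exact ⟨0, fun q _ => by simp⟩
  | @cons x y _ hadj _ ih =>
    obtain ⟨B, hB⟩ := ih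
    refine ⟨dist (p x) (p y) + B, fun q hq => ?_⟩
    refine (dist_triangle _ _ _).trans (add_le_add (hq _ _ hadj).le (hB q hq))

end

/-! ### Centered placements and the driving vector field -/

section

open Module

/-- The placements with the edge lengths of `(Γ, p)` and with centroid at the origin. -/
def centeredFiber {V : Type*} [Fintype V] {d : ℕ} (Γ : SimpleGraph V) (p : Placement V d) :
    Set (Placement V d) :=
  {q | (∀ v w, Γ.Adj v w → dist (q v) (q w) = dist (p v) (p w)) ∧ ∑ v, q v = 0}

/-- With the centroid at 0, `card V • q v` is the sum of the differences `q v - q w`, which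
connectedness bounds. -/
theorem exists_norm_le_of_mem_centeredFiber {V : Type*} [Fintype V] [Nonempty V] {d : ℕ}
    {Γ : SimpleGraph V} (hΓ : Γ.Preconnected) (p : Placement V d) :
    ∃ C : ℝ, ∀ q ∈ centeredFiber Γ p, ∀ v, ‖q v‖ ≤ C := by
  choose B hB using fun v w => exists_dist_le_of_reachable p (hΓ v w)
  refine ⟨∑ v, ∑ w, |B v w|, fun q hq v => ?_⟩
  have h1 : (Fintype.card V : ℝ) • q v = ∑ w, (q v - q w) := by
    rw [Finset.sum_sub_distrib, hq.2, sub_zero, Finset.sum_const, Finset.card_univ, Nat.cast_smul_eq_nsmul]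
  have h2 : (Fintype.card V : ℝ) * ‖q v‖ ≤ ∑ w, |B v w| := by
    rw [← Real.norm_of_nonneg (Nat.cast_nonneg (Fintype.card V)), ← norm_smul, h1]
    refine (norm_sum_le _ _).trans (Finset.sum_le_sum fun w _ => ?_)
    rw [← dist_eq_norm]
    exact (hB v w q hq.1).trans (le_abs_self _)
  have h3 : (1 : ℝ) ≤ Fintype.card V := by exact_mod_cast Fintype.card_pos
  have h4 : ∑ w, |B v w| ≤ ∑ v, ∑ w, |B v w| :=
    Finset.single_le_sum (f := fun v => ∑ w, |B v w|)
      (fun v _ => Finset.sum_nonneg fun w _ => abs_nonneg _) (Finset.mem_univ v)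
  nlinarith [norm_nonneg (q v)]

theorem isCompact_centeredFiber {V : Type*} [Fintype V] [Nonempty V] {d : ℕ}
    {Γ : SimpleGraph V} (hΓ : Γ.Preconnected) (p : Placement V d) :
    IsCompact (centeredFiber Γ p) := by
  obtain ⟨C, hC⟩ := exists_norm_le_of_mem_centeredFiber hΓ p
  refine Metric.isCompact_of_isClosed_isBounded ?_ ?_
  · have hset : centeredFiber Γ p = (⋂ v, ⋂ w, ⋂ _ : Γ.Adj v w,
        {q | dist (q v) (q w) = dist (p v) (p w)}) ∩ {q | ∑ v, q v = 0} := by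
      ext q; simp [centeredFiber]
    rw [hset]
    refine IsClosed.inter ?_ (isClosed_eq (by fun_prop) continuous_const)
    exact isClosed_iInter fun v => isClosed_iInter fun w => isClosed_iInter fun _ =>
      isClosed_eq (by fun_prop) continuous_const
  · refine (Metric.isBounded_closedBall (x := (0 : Placement V d)) (r := |C|)).subset fun q hq => ?_
    rw [mem_closedBall_zero_iff, pi_norm_le_iff_of_nonneg (abs_nonneg C)]
    exact fun v => (hC q hq v).trans (le_abs_self C)

/-- The action of linear isometries on placements. -/
noncomputable def placementAction (V : Type*) (d : ℕ) :
    (EuclideanSpace ℝ (Fin d) ≃ₗᵢ[ℝ] EuclideanSpace ℝ (Fin d)) →* (Placement V d →ₗ[ℝ] Placement V d) where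
  toFun R := (R.toLinearEquiv : EuclideanSpace ℝ (Fin d) →ₗ[ℝ] EuclideanSpace ℝ (Fin d)).compLeft V
  map_one' := rfl
  map_mul' _ _ := rfl

@[simp]
theorem placementAction_apply {V : Type*} {d : ℕ}
    (R : EuclideanSpace ℝ (Fin d) ≃ₗᵢ[ℝ] EuclideanSpace ℝ (Fin d)) (q : Placement V d) (v : V) :
    placementAction V d R q v = R (q v) := rfl

/-- The adjoint action of linear isometries on infinitesimal rigid motions. -/
noncomputable def rigidVelocityAction (d : ℕ) :
    (EuclideanSpace ℝ (Fin d) ≃ₗᵢ[ℝ] EuclideanSpace ℝ (Fin d)) →*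
      (RigidVelocity d →ₗ[ℝ] RigidVelocity d) where
  toFun R :=
    { toFun := fun z =>
        (⟨(R : EuclideanSpace ℝ (Fin d) →L[ℝ] EuclideanSpace ℝ (Fin d)) ∘L z.1.1 ∘L
            (R.symm : EuclideanSpace ℝ (Fin d) →L[ℝ] EuclideanSpace ℝ (Fin d)), fun x y => by
          have h := z.1.2 (R.symm x) (R.symm y)
          rw [← R.inner_map_map, ← R.inner_map_map (R.symm x)] at h
          simpa using h⟩, R z.2)
      map_add' := fun z z' => by
        refine Prod.ext (Subtype.ext ?_) ?_
        · ext1 x; simp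
        · simp
      map_smul' := fun c z => by
        refine Prod.ext (Subtype.ext ?_) ?_
        · ext1 x; simp
        · simp }
  map_one' := rfl
  map_mul' _ _ := rfl

theorem rigidVelocity_placementAction {V : Type*} {d : ℕ}
    (R : EuclideanSpace ℝ (Fin d) ≃ₗᵢ[ℝ] EuclideanSpace ℝ (Fin d)) (q : Placement V d)
    (z : RigidVelocity d) :
    rigidVelocity (placementAction V d R q) z =
      placementAction V d R (rigidVelocity q (rigidVelocityAction d R⁻¹ z)) := by
  ext1 v
  simp only [rigidVelocity_apply, placementAction_apply, map_add]
  congr 1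
  · change z.1.1 (R (q v)) = R (R.symm (z.1.1 (R (q v))))
    rw [R.apply_symm_apply]
  · exact (R.apply_symm_apply z.2).symm

theorem placementInner_placementAction {V : Type*} [Fintype V] {d : ℕ}
    (R : EuclideanSpace ℝ (Fin d) ≃ₗᵢ[ℝ] EuclideanSpace ℝ (Fin d)) (u w : Placement V d) :
    placementInner (placementAction V d R u) (placementAction V d R w) = placementInner u w :=
  Finset.sum_congr rfl fun v _ => R.inner_map_map (u v) (w v)

/-- This is the intertwining relation to which the naturality of the cross product applies:
isometries fix edge stretches and transform momenta by the dual of the adjoint action. -/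
theorem constraintMap_placementAction {V : Type*} [Fintype V] {d : ℕ} (Γ : SimpleGraph V)
    (R : EuclideanSpace ℝ (Fin d) ≃ₗᵢ[ℝ] EuclideanSpace ℝ (Fin d)) (q : Placement V d) :
    constraintMap Γ (placementAction V d R q) ∘ₗ placementAction V d R =
      (LinearMap.prodMap LinearMap.id (rigidVelocityAction d R⁻¹).dualMap) ∘ₗ
        constraintMap Γ q := by
  refine LinearMap.ext fun u => Prod.ext ?_ ?_
  · refine (rigidityMap_eq_iff _ _ _ _ _).2 fun v w _ => ?_
    simp only [placementAction_apply, ← map_sub]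
    exact R.inner_map_map _ _
  · refine LinearMap.ext fun z => ?_
    change placementInner (rigidVelocity (placementAction V d R q) z) (placementAction V d R u) =
      placementInner (rigidVelocity q (rigidVelocityAction d R⁻¹ z)) u
    rw [rigidVelocity_placementAction, placementInner_placementAction]

/-- The constraint map is affine in `q`: the rigidity part is linear by symmetry, and the momentum
part has a constant term coming from translations. -/
theorem contDiff_constraintMap_apply {V : Type*} [Fintype V] {d : ℕ} (Γ : SimpleGraph V)
    (ξ : (Γ.edgeSet → ℝ) × Dual ℝ (RigidVelocity d) →ₗ[ℝ] ℝ) (u : Placement V d) :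
    ContDiff ℝ 1 fun q => ξ (constraintMap Γ q u) := by
  have hmom : ∀ q q' : Placement V d, ∀ c : ℝ,
      momentMap (q + c • q') u - momentMap 0 u =
        (momentMap q u - momentMap 0 u) + c • (momentMap q' u - momentMap 0 u) := by
    intro q q' c
    refine LinearMap.ext fun z => ?_
    simp only [LinearMap.sub_apply, LinearMap.add_apply, LinearMap.smul_apply, momentMap_apply,
      placementInner_apply, rigidVelocity_apply, Pi.add_apply, Pi.smul_apply, Pi.zero_apply,
      map_add, map_smul, map_zero, inner_add_left, inner_smul_left, inner_zero_left,
      Finset.sum_add_distrib, ← Finset.mul_sum, Finset.sum_const_zero, smul_eq_mul, conj_trivial]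
    ring
  have hrig : ∀ q q' : Placement V d, ∀ c : ℝ,
      rigidityMap Γ (q + c • q') u = rigidityMap Γ q u + c • rigidityMap Γ q' u := by
    intro q q' c
    rw [rigidityMap_comm, map_add, map_smul, rigidityMap_comm Γ u q, rigidityMap_comm Γ u q']
  have hz : rigidityMap Γ 0 u = 0 := by rw [rigidityMap_comm, map_zero]
  have key : ∀ q q' : Placement V d, ∀ c : ℝ,
      ξ (constraintMap Γ (q + c • q') u - constraintMap Γ 0 u) =
        ξ (constraintMap Γ q u - constraintMap Γ 0 u) +
          c • ξ (constraintMap Γ q' u - constraintMap Γ 0 u) := by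
    intro q q' c
    rw [← map_smul, ← map_add]
    congr 1
    refine Prod.ext ?_ (hmom q q' c)
    change rigidityMap Γ (q + c • q') u - rigidityMap Γ 0 u =
      (rigidityMap Γ q u - rigidityMap Γ 0 u) + c • (rigidityMap Γ q' u - rigidityMap Γ 0 u)
    rw [hz, hrig]
    simp
  let Λ : Placement V d →ₗ[ℝ] ℝ :=
    { toFun := fun q => ξ (constraintMap Γ q u - constraintMap Γ 0 u)
      map_add' := fun q q' => by simpa using key q q' 1
      map_smul' := fun c q => by simpa using key 0 q c }
  have hΛ : (fun q => ξ (constraintMap Γ q u)) =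
      fun q => Λ.toContinuousLinearMap q + ξ (constraintMap Γ 0 u) := by
    ext q
    change _ = ξ (constraintMap Γ q u - constraintMap Γ 0 u) + _
    rw [map_sub, sub_add_cancel]
  rw [hΛ]
  exact (ContinuousLinearMap.contDiff _).add contDiff_const

/-- The mechanism `(G - ab, p)` is driven by a bounded Lipschitz vector field that satisfies the
linearized constraints everywhere, vanishes nowhere on the centered placements of the mechanism,
and is equivariant under rotations. -/
theorem IsIsostatic.exists_vectorField {V : Type*} [Fintype V] {d : ℕ} {G : SimpleGraph V}
    {p : Placement V d} (h : IsIsostatic G p) (hgen : IsGenericPlacement p) (hd : 2 ≤ d)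
    (hV : d + 1 ≤ Fintype.card V) {a b : V} (hab : G.Adj a b) :
    ∃ (W : Placement V d → Placement V d) (K L : NNReal), LipschitzWith K W ∧ (∀ q, ‖W q‖ ≤ L) ∧
      (∀ q, constraintMap (G.deleteEdges {s(a, b)}) q (W q) = 0) ∧
      (∀ q ∈ centeredFiber (G.deleteEdges {s(a, b)}) p, W q ≠ 0) ∧
      ∀ (R : EuclideanSpace ℝ (Fin d) ≃ₗᵢ[ℝ] EuclideanSpace ℝ (Fin d)) (q : Placement V d),
        LinearMap.det (R.toLinearEquiv : EuclideanSpace ℝ (Fin d) →ₗ[ℝ] EuclideanSpace ℝ (Fin d)) = 1 →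
        W (placementAction V d R q) = placementAction V d R (W q) := by
  have : Nonempty V := ⟨a⟩
  set H := G.deleteEdges {s(a, b)}
  obtain ⟨W, hWs, hWL, hW0, hWeq⟩ := exists_cross_product
    (h.finrank_placement_deleteEdges hV hab) (constraintMap H)
    (contDiff_constraintMap_apply H)
  obtain ⟨C, hC⟩ := exists_norm_le_of_mem_centeredFiber (h.preconnected_deleteEdges hd hV a b) p
  -- A rotation-invariant cutoff, equal to 1 on the centered placements, where every `‖q v‖ ≤ C`.
  -- Compact support turns the C¹ field into a bounded, globally Lipschitz one.
  let β : Placement V d → ℝ := fun q =>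
    Real.smoothTransition (∑ _v : V, C ^ 2 + 1 - ∑ v, ‖q v‖ ^ 2)
  have hβ : ContDiff ℝ 1 β := by
    refine Real.smoothTransition.contDiff.comp (contDiff_const.sub (ContDiff.sum fun v _ => ?_))
    exact (contDiff_apply ℝ _ v).norm_sq ℝ
  have hβ1 : ∀ q ∈ centeredFiber H p, β q = 1 := by
    intro q hq
    refine Real.smoothTransition.one_of_one_le ?_
    have : ∑ v, ‖q v‖ ^ 2 ≤ ∑ _v : V, C ^ 2 :=
      Finset.sum_le_sum fun v _ => pow_le_pow_left₀ (norm_nonneg _) (hC q hq v) 2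
    linarith
  have hsmooth : ContDiff ℝ 1 fun q => β q • W q := hβ.smul hWs
  have hsupp : HasCompactSupport fun q => β q • W q := by
    refine HasCompactSupport.intro
      (isCompact_closedBall (0 : Placement V d) (∑ _v : V, C ^ 2 + 1 + 1)) fun q hq => ?_
    have hβ0 : β q = 0 := by
      refine Real.smoothTransition.zero_of_nonpos ?_
      by_contra! hpos
      refine hq ?_
      have hS : 0 ≤ ∑ _v : V, C ^ 2 := Finset.sum_nonneg fun _ _ => sq_nonneg C
      rw [mem_closedBall_zero_iff, pi_norm_le_iff_of_nonneg (by linarith)]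
      intro v
      have h1 : ‖q v‖ ^ 2 ≤ ∑ v, ‖q v‖ ^ 2 :=
        Finset.single_le_sum (f := fun v => ‖q v‖ ^ 2) (fun _ _ => sq_nonneg _) (Finset.mem_univ v)
      nlinarith [norm_nonneg (q v), sq_nonneg (‖q v‖ - 1)]
    rw [hβ0, zero_smul]
  obtain ⟨K, hK⟩ := ContDiff.lipschitzWith_of_hasCompactSupport hsupp hsmooth one_ne_zero
  obtain ⟨L, hL⟩ := hsupp.exists_bound_of_continuous hsmooth.continuous
  refine ⟨fun q => β q • W q, K, L.toNNReal, hK, fun q => (hL q).trans (Real.le_coe_toNNReal L),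
    fun q => ?_, fun q hq => ?_, fun R q hR => ?_⟩
  · rw [map_smul, hWL, smul_zero]
  · change β q • W q ≠ 0
    rw [hβ1 q hq, one_smul]
    exact hW0 q (h.constraintMap_surjective hgen hV hab hq.1)
  · have hβR : β (placementAction V d R q) = β q := by
      simp only [β, placementAction_apply, R.norm_map]
    have hinv : placementAction V d R ∘ₗ placementAction V d R⁻¹ = LinearMap.id := by
      change placementAction V d R * placementAction V d R⁻¹ = 1
      rw [← map_mul, mul_inv_cancel, map_one]
    -- The determinant factor from the cross product is the value at `R⁻¹` of this character of the
    -- orthogonal group.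
    let χ : (EuclideanSpace ℝ (Fin d) ≃ₗᵢ[ℝ] EuclideanSpace ℝ (Fin d)) →* ℝ :=
      (LinearMap.det.comp (rigidVelocityAction d)) * (LinearMap.det.comp (placementAction V d))
    have hχR : χ R = 1 := map_eq_one_of_det_eq_one χ R hR
    have hχ : χ R⁻¹ = 1 := by
      have := map_mul χ R R⁻¹
      rwa [mul_inv_cancel, map_one, hχR, one_mul, eq_comm] at this
    have hfac : LinearMap.det (LinearMap.prodMap (LinearMap.id : (H.edgeSet → ℝ) →ₗ[ℝ] _)
        (rigidVelocityAction d R⁻¹).dualMap) * LinearMap.det (placementAction V d R⁻¹) = 1 := by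
      rw [LinearMap.det_prodMap, LinearMap.det_id, one_mul, LinearMap.det_dualMap]
      exact hχ
    have := hWeq _ _ _ q _ hinv (constraintMap_placementAction H R q)
    rw [hfac, one_smul] at this
    change β _ • W _ = placementAction V d R (β q • W q)
    rw [this, hβR, map_smul]

end

/-! ### Momentum-free motions and conserved quantities -/

section

open Module Filter Topology

/-- For centered placements the distances determine the Gram matrix: sums of squared distances give
the norms, and polarization gives the rest. -/
theorem inner_eq_of_dist_eq {V : Type*} [Fintype V] {d : ℕ} {q q' : Placement V d}
    (hq : ∑ v, q v = 0) (hq' : ∑ v, q' v = 0)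
    (h : ∀ v w, dist (q v) (q w) = dist (q' v) (q' w)) (v w : V) :
    (inner ℝ (q v) (q w) : ℝ) = inner ℝ (q' v) (q' w) := by
  have hn : (0 : ℝ) < Fintype.card V := by
    have : Nonempty V := ⟨v⟩
    exact_mod_cast Fintype.card_pos
  -- the distances from one vertex determine its norm up to the moment of inertia
  have hsum : ∀ r : Placement V d, ∑ v, r v = 0 → ∀ v,
      ∑ w, dist (r v) (r w) ^ 2 = Fintype.card V * ‖r v‖ ^ 2 + ∑ w, ‖r w‖ ^ 2 := by
    intro r hr v
    simp only [dist_eq_norm, norm_sub_sq_real, Finset.sum_add_distrib, Finset.sum_sub_distrib,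
      ← Finset.mul_sum, ← inner_sum, hr, inner_zero_right, Finset.sum_const, Finset.card_univ,
      nsmul_eq_mul]
    ring
  have htot : ∀ r : Placement V d, ∑ v, r v = 0 →
      ∑ v, ∑ w, dist (r v) (r w) ^ 2 = 2 * Fintype.card V * ∑ w, ‖r w‖ ^ 2 := by
    intro r hr
    simp only [hsum r hr, Finset.sum_add_distrib, ← Finset.mul_sum, Finset.sum_const,
      Finset.card_univ, nsmul_eq_mul]
    ring
  have hS : ∑ w, ‖q w‖ ^ 2 = ∑ w, ‖q' w‖ ^ 2 := by
    have := (htot q hq).symm.trans ((by simp only [h]) : _ = _) |>.trans (htot q' hq')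
    exact mul_left_cancel₀ (by positivity) this
  have hN : ∀ v, ‖q v‖ ^ 2 = ‖q' v‖ ^ 2 := by
    intro v
    have := (hsum q hq v).symm.trans ((by simp only [h]) : _ = _) |>.trans (hsum q' hq' v)
    rw [hS] at this
    exact mul_left_cancel₀ hn.ne' (add_right_cancel this)
  have hvw := congrArg (· ^ 2) (h v w)
  simp only [dist_eq_norm, norm_sub_sq_real, hN] at hvw
  linarith

/-- A velocity without momentum along which all distances are constant vanishes. -/
theorem eq_zero_of_momentMap_of_dist_const {V : Type*} [Fintype V] {d : ℕ}
    {γ : ℝ → Placement V d} {w : Placement V d} (hγ : HasDerivAt γ w 0)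
    (hmom : momentMap (γ 0) w = 0) (hcent : ∀ t, ∑ v, γ t v = 0)
    (hdist : ∀ t x y, dist (γ t x) (γ t y) = dist (γ 0 x) (γ 0 y)) : w = 0 := by
  have hgram : ∀ t x y, (inner ℝ (γ t x) (γ t y) : ℝ) = inner ℝ (γ 0 x) (γ 0 y) := fun t =>
    inner_eq_of_dist_eq (hcent t) (hcent 0) (hdist t)
  have hγv : ∀ v, HasDerivAt (fun t => γ t v) (w v) 0 := fun v => (hasDerivAt_pi.1 hγ) v
  set q := γ 0 with hq
  have hK : ∀ x y, (inner ℝ (q x) (w y) : ℝ) = -inner ℝ (w x) (q y) := by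
    intro x y
    have h1 := (hγv x).inner ℝ (hγv y)
    have h2 : HasDerivAt (fun t => (inner ℝ (γ t x) (γ t y) : ℝ)) 0 0 := by
      simp only [hgram]
      exact hasDerivAt_const _ _
    have := h1.unique h2
    simp only [← hq] at this
    linarith
  -- Pairing the momentum with rank-two skew maps shows that `∑ v, q v ⊗ w v` is a symmetric matrix.
  have hsymm : ∀ y z : EuclideanSpace ℝ (Fin d),
      ∑ v, inner ℝ y (q v) * inner ℝ z (w v) = ∑ v, inner ℝ z (q v) * inner ℝ y (w v) := by
    intro y z
    let A : EuclideanSpace ℝ (Fin d) →L[ℝ] EuclideanSpace ℝ (Fin d) :=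
      (innerSL ℝ y).smulRight z - (innerSL ℝ z).smulRight y
    have hA : A ∈ skewMaps (EuclideanSpace ℝ (Fin d)) := by
      intro x x'
      simp only [A, sub_apply, ContinuousLinearMap.smulRight_apply, innerSL_apply_apply,
        inner_sub_left, inner_sub_right, inner_smul_left, inner_smul_right, conj_trivial]
      rw [real_inner_comm z x, real_inner_comm y x]
      ring
    have h1 : momentMap q w (⟨A, hA⟩, 0) = 0 := by rw [hmom]; rfl
    rw [momentMap_apply, placementInner_apply] at h1
    simp only [rigidVelocity_apply, A, add_zero, sub_apply, ContinuousLinearMap.smulRight_apply,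
      innerSL_apply_apply, inner_sub_left, inner_smul_left, conj_trivial,
      Finset.sum_sub_distrib] at h1
    exact sub_eq_zero.1 h1
  let S : Fin d → Fin d → ℝ := fun i j => ∑ v, q v i * w v j
  have hSsymm : ∀ i j, S i j = S j i := by
    intro i j
    have := hsymm (EuclideanSpace.single i 1) (EuclideanSpace.single j 1)
    simpa [S, EuclideanSpace.inner_single_left] using this
  have hcoord : ∀ x y : EuclideanSpace ℝ (Fin d), (inner ℝ x y : ℝ) = ∑ i, x i * y i := by
    intro x y
    rw [PiLp.inner_apply]
    exact Finset.sum_congr rfl fun i _ => mul_comm _ _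
  -- By symmetry of `S` the left side is the trace of `S²`; the antisymmetry `hK` makes that trace
  -- minus a sum of squares, so `S = 0`.
  have hSS : ∑ i, ∑ j, S i j ^ 2 = -∑ x, ∑ y, (inner ℝ (q x) (w y) : ℝ) ^ 2 := by
    have h1 : ∑ i, ∑ j, S i j ^ 2 = ∑ x, ∑ y, (inner ℝ (q x) (w y) : ℝ) * inner ℝ (w x) (q y) := by
      calc ∑ i, ∑ j, S i j ^ 2 = ∑ i, ∑ j, ∑ x, ∑ y, (q x i * w x j) * (q y j * w y i) := by
            refine Finset.sum_congr rfl fun i _ => Finset.sum_congr rfl fun j _ => ?_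
            rw [sq]; nth_rewrite 2 [hSsymm]
            rw [Finset.sum_mul_sum]
        _ = ∑ i, ∑ x, ∑ y, ∑ j, (q x i * w x j) * (q y j * w y i) := by
            refine Finset.sum_congr rfl fun i _ => ?_
            rw [Finset.sum_comm]
            exact Finset.sum_congr rfl fun x _ => Finset.sum_comm
        _ = ∑ x, ∑ y, ∑ i, ∑ j, (q x i * w x j) * (q y j * w y i) := by
            rw [Finset.sum_comm]
            exact Finset.sum_congr rfl fun x _ => Finset.sum_comm
        _ = _ := by
            refine Finset.sum_congr rfl fun x _ => Finset.sum_congr rfl fun y _ => ?_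
            rw [hcoord, hcoord, Finset.sum_mul_sum]
            exact Finset.sum_congr rfl fun i _ => Finset.sum_congr rfl fun j _ => by ring
    rw [h1, ← Finset.sum_neg_distrib]
    refine Finset.sum_congr rfl fun x _ => ?_
    rw [← Finset.sum_neg_distrib]
    refine Finset.sum_congr rfl fun y _ => ?_
    rw [hK x y]
    ring
  have hS0 : ∀ i j, S i j = 0 := by
    have hneg : ∑ i, ∑ j, S i j ^ 2 ≤ 0 := by
      rw [hSS, neg_nonpos]
      exact Finset.sum_nonneg fun x _ => Finset.sum_nonneg fun y _ => sq_nonneg _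
    intro i j
    have h1 : S i j ^ 2 ≤ ∑ j, S i j ^ 2 :=
      Finset.single_le_sum (f := fun j => S i j ^ 2) (fun _ _ => sq_nonneg _) (Finset.mem_univ j)
    have h2 : ∑ j, S i j ^ 2 ≤ ∑ i, ∑ j, S i j ^ 2 :=
      Finset.single_le_sum (f := fun i => ∑ j, S i j ^ 2)
        (fun _ _ => Finset.sum_nonneg fun _ _ => sq_nonneg _) (Finset.mem_univ i)
    exact pow_eq_zero_iff two_ne_zero |>.1 (le_antisymm (by linarith) (sq_nonneg _))
  -- `S = 0` is a linear relation among the points `q v` with coefficients `w v j`. The constant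
  -- Gram matrix preserves it along `γ`, so it can be differentiated; coordinate `j` of the result
  -- is `∑ v, w v j ^ 2 = 0`.
  have hfinal : ∀ j, ∑ v, w v j • w v = 0 := by
    intro j
    have hq0 : ∑ v, w v j • q v = 0 := by
      ext i
      have := hS0 i j
      simpa [S, mul_comm] using this
    have hzero : ∀ t, ∑ v, w v j • γ t v = 0 := by
      intro t
      have hnorm : ∀ r : Placement V d, (inner ℝ (∑ v, w v j • r v) (∑ v, w v j • r v) : ℝ) =
          ∑ x, ∑ y, w x j * (w y j * inner ℝ (r x) (r y)) := by
        intro r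
        simp only [sum_inner, inner_sum, inner_smul_left, inner_smul_right, conj_trivial,
          Finset.mul_sum]
        exact Finset.sum_congr rfl fun x _ => Finset.sum_congr rfl fun y _ => by
          rw [real_inner_comm]
      refine inner_self_eq_zero (𝕜 := ℝ).1 ?_
      rw [hnorm]
      simp only [hgram]
      rw [← hnorm, hq0, inner_zero_left]
    have h1 : HasDerivAt (fun t => ∑ v, w v j • γ t v) (∑ v, w v j • w v) 0 :=
      HasDerivAt.fun_sum fun v _ => (hγv v).const_smul (w v j)
    simp only [hzero] at h1
    exact h1.unique (hasDerivAt_const _ _)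
  ext v j
  have h1 : ∑ v, w v j ^ 2 = 0 := by
    have := congrArg (fun x : EuclideanSpace ℝ (Fin d) => x j) (hfinal j)
    simpa [sq] using this
  rw [Finset.sum_eq_zero_iff_of_nonneg fun v _ => sq_nonneg _] at h1
  exact pow_eq_zero_iff two_ne_zero |>.1 (h1 v (Finset.mem_univ v))

section Flow

variable {V : Type*} [Fintype V] {d : ℕ} {Γ : SimpleGraph V}
  {W : Placement V d → Placement V d} {φ : ℝ → Placement V d → Placement V d}

theorem IsGlobalFlow.hasDerivAt_dist_sq (hφ : IsGlobalFlow W φ) (x : Placement V d) (v w : V)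
    (t : ℝ) : HasDerivAt (fun t => dist (φ t x v) (φ t x w) ^ 2)
      (2 * inner ℝ (φ t x v - φ t x w) (W (φ t x) v - W (φ t x) w)) t := by
  have h := hasDerivAt_pi.1 (hφ.deriv x t)
  simpa only [dist_eq_norm, Pi.sub_apply] using ((h v).sub (h w)).norm_sq

theorem IsGlobalFlow.dist_eq (hφ : IsGlobalFlow W φ)
    (hW : ∀ q, constraintMap Γ q (W q) = 0) (x : Placement V d) (t : ℝ) {v w : V}
    (hvw : Γ.Adj v w) : dist (φ t x v) (φ t x w) = dist (x v) (x w) := by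
  have hd : ∀ t, HasDerivAt (fun t => dist (φ t x v) (φ t x w) ^ 2) 0 t := by
    intro t
    have h1 := hφ.hasDerivAt_dist_sq x v w t
    have h2 := mem_ker_rigidityMap.1 (constraintMap_eq_zero_iff.1 (hW (φ t x))).1 v w hvw
    rwa [h2, mul_zero] at h1
  have := is_const_of_deriv_eq_zero (fun t => (hd t).differentiableAt) (fun t => (hd t).deriv) t 0
  rw [hφ.zero] at this
  exact (pow_left_inj₀ dist_nonneg dist_nonneg two_ne_zero).1 this

theorem sum_eq_zero_of_momentMap {q u : Placement V d} (h : momentMap q u = 0) :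
    ∑ v, u v = 0 := by
  refine ext_inner_left ℝ fun t => ?_
  have : momentMap q u (0, t) = 0 := by rw [h]; rfl
  rw [momentMap_apply, placementInner_apply] at this
  simpa [rigidVelocity_apply, inner_sum] using this

theorem IsGlobalFlow.sum_eq (hφ : IsGlobalFlow W φ)
    (hW : ∀ q, constraintMap Γ q (W q) = 0) (x : Placement V d) (t : ℝ) :
    ∑ v, φ t x v = ∑ v, x v := by
  have hd : ∀ t, HasDerivAt (fun t => ∑ v, φ t x v) 0 t := by
    intro t
    have h := hasDerivAt_pi.1 (hφ.deriv x t)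
    have h1 : HasDerivAt (fun t => ∑ v, φ t x v) (∑ v, W (φ t x) v) t :=
      HasDerivAt.fun_sum fun v _ => h v
    rwa [sum_eq_zero_of_momentMap (constraintMap_eq_zero_iff.1 (hW (φ t x))).2] at h1
  have := is_const_of_deriv_eq_zero (fun t => (hd t).differentiableAt) (fun t => (hd t).deriv) t 0
  simpa only [hφ.zero] using this

theorem IsGlobalFlow.mem_centeredFiber (hφ : IsGlobalFlow W φ)
    (hW : ∀ q, constraintMap Γ q (W q) = 0) {p x : Placement V d} (hx : x ∈ centeredFiber Γ p)
    (t : ℝ) : φ t x ∈ centeredFiber Γ p :=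
  ⟨fun v w hvw => (hφ.dist_eq hW x t hvw).trans (hx.1 v w hvw), (hφ.sum_eq hW x t).trans hx.2⟩

end Flow

end

/-! ### Local structure of the mechanism -/

section

open Module Filter Topology NormedSpace

/-- The rigidity map depends linearly on the placement. -/
noncomputable def rigidityBilin {V : Type*} {d : ℕ} (Γ : SimpleGraph V) :
    Placement V d →ₗ[ℝ] Placement V d →ₗ[ℝ] (Γ.edgeSet → ℝ) :=
  LinearMap.mk₂ ℝ (fun q u => rigidityMap Γ q u)
    (fun q q' u => by rw [rigidityMap_comm, map_add, rigidityMap_comm, rigidityMap_comm Γ u])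
    (fun c q u => by rw [rigidityMap_comm, map_smul, rigidityMap_comm])
    (fun q u u' => map_add _ _ _) (fun c q u => map_smul _ _ _)

theorem eventually_injective_comp {E F N : Type*} [NormedAddCommGroup E] [NormedSpace ℝ E]
    [FiniteDimensional ℝ E] [NormedAddCommGroup F] [NormedSpace ℝ F] [FiniteDimensional ℝ F]
    [NormedAddCommGroup N] [NormedSpace ℝ N] [FiniteDimensional ℝ N] (B : E →ₗ[ℝ] E →ₗ[ℝ] F)
    (j : N →ₗ[ℝ] E) {q : E} (hq : Function.Injective (B q ∘ₗ j)) :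
    ∀ᶠ x in 𝓝 q, Function.Injective (B x ∘ₗ j) := by
  let Λ : E →ₗ[ℝ] (N →L[ℝ] F) :=
    LinearMap.toContinuousLinearMap.toLinearMap ∘ₗ (LinearMap.lcomp ℝ F j) ∘ₗ B
  have hΛ : Continuous Λ := LinearMap.continuous_of_finiteDimensional Λ
  exact hΛ.continuousAt.eventually (ContinuousLinearMap.isOpen_injective.eventually_mem hq)

/-- A finite-dimensional subspace is the image of an injective linear map from a standard space. -/
theorem Submodule.exists_parametrization {E : Type*} [NormedAddCommGroup E] [NormedSpace ℝ E]
    [FiniteDimensional ℝ E] (P : Submodule ℝ E) :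
    ∃ j : (Fin (finrank ℝ P) → ℝ) →L[ℝ] E, Function.Injective j ∧ ∀ x, x ∈ P ↔ ∃ z, j z = x := by
  let e := (finBasis ℝ P).equivFun.symm
  refine ⟨LinearMap.toContinuousLinearMap (P.subtype ∘ₗ e.toLinearMap),
    P.injective_subtype.comp e.injective, fun x => ⟨fun hx => ⟨e.symm ⟨x, hx⟩, ?_⟩, ?_⟩⟩
  · change ((e (e.symm ⟨x, hx⟩) : P) : E) = x
    rw [e.apply_symm_apply]
  · rintro ⟨z, rfl⟩
    exact (e z).2

/-- Transversally to the infinitesimal motions, the edge lengths determine a placement locally. -/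
theorem eventually_eq_zero_of_rigidityMap_eq {V : Type*} [Fintype V] {d : ℕ} {T : Type*}
    [NormedAddCommGroup T] [NormedSpace ℝ T] [FiniteDimensional ℝ T] (Γ : SimpleGraph V)
    (q : Placement V d) (j : T →L[ℝ] Placement V d)
    (hj : ∀ n, rigidityMap Γ q (j n) = 0 → n = 0) :
    ∀ᶠ n : T in 𝓝 0, (∀ v w, Γ.Adj v w →
      dist ((q + j n) v) ((q + j n) w) = dist (q v) (q w)) → n = 0 := by
  let _ := Fintype.ofFinite Γ.edgeSet
  have hinj : Function.Injective (rigidityBilin Γ q ∘ₗ j.toLinearMap) := by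
    rw [← LinearMap.ker_eq_bot, LinearMap.ker_eq_bot']
    exact hj
  -- The change of squared edge lengths from `q` to `q + j n` is exactly twice the rigidity map at
  -- the midpoint applied to `j n`, and injectivity on the range of `j` persists near `q`.
  have hcont : Tendsto (fun n : T => q + (1 / 2 : ℝ) • j n) (𝓝 0) (𝓝 q) := by
    have : Continuous fun n : T => q + (1 / 2 : ℝ) • j n := by fun_prop
    simpa using this.tendsto 0
  filter_upwards [hcont.eventually (eventually_injective_comp _ _ hinj)] with n hn hdist
  refine hn (a₁ := n) (a₂ := 0) (Eq.trans ?_ (map_zero _).symm)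
  change rigidityMap Γ (q + (1 / 2 : ℝ) • j n) (j n) = 0
  rw [← LinearMap.mem_ker, mem_ker_rigidityMap]
  intro v w hvw
  have h1 := congrArg (· ^ 2) (hdist v w hvw)
  simp only [dist_eq_norm, Pi.add_apply, add_sub_add_comm, norm_add_sq_real] at h1
  simp only [Pi.add_apply, Pi.smul_apply, add_sub_add_comm, ← smul_sub, inner_add_left,
    inner_smul_left, conj_trivial, real_inner_self_eq_norm_sq]
  linarith

/-- Subtracting the trivial motion with the momentum of `k` leaves a vector in the kernel of the
constraint map, a line spanned by `u`. -/
theorem exists_rigidVelocity_add_smul {V : Type*} [Fintype V] {d : ℕ} {Γ : SimpleGraph V}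
    {q u k : Placement V d} (hq : Function.Injective (rigidVelocity q))
    (hdim : finrank ℝ (Placement V d) =
      finrank ℝ ((Γ.edgeSet → ℝ) × Dual ℝ (RigidVelocity d)) + 1)
    (hsurj : Function.Surjective (constraintMap Γ q)) (hu : constraintMap Γ q u = 0) (hu0 : u ≠ 0)
    (hk : k ∈ LinearMap.ker (rigidityMap Γ q)) : ∃ z : RigidVelocity d, ∃ r : ℝ,
      k = rigidVelocity q z + r • u := by
  obtain ⟨z, hz⟩ := (momentMap_comp_rigidVelocity_bijective hq).2 (momentMap q k)
  have hker : finrank ℝ (LinearMap.ker (constraintMap Γ q)) = 1 := by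
    have := (constraintMap Γ q).finrank_range_add_finrank_ker
    rw [LinearMap.range_eq_top.2 hsurj, finrank_top, hdim] at this
    omega
  have hmem : k - rigidVelocity q z ∈ LinearMap.ker (constraintMap Γ q) := by
    rw [LinearMap.mem_ker, constraintMap_eq_zero_iff, map_sub, map_sub, LinearMap.mem_ker.1 hk,
      LinearMap.mem_ker.1 (rigidVelocity_mem_ker Γ q z), sub_zero]
    exact ⟨rfl, sub_eq_zero.2 hz.symm⟩
  obtain ⟨r, hr⟩ := (finrank_eq_one_iff_of_nonzero' (⟨u, hu⟩ : LinearMap.ker (constraintMap Γ q))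
    (fun h => hu0 (congrArg Subtype.val h))).1 hker ⟨_, hmem⟩
  refine ⟨z, r, ?_⟩
  have hr' : r • u = k - rigidVelocity q z := congrArg Subtype.val hr
  rw [hr']
  abel

/-- By the product rule at `exp 0 = 1`, the derivative is an infinitesimal rigid motion plus that of
`f`. Here `ι` parametrizes skew maps, `j` transversal displacements, and `f` will be the flow. -/
theorem exists_hasStrictFDerivAt_exp_apply {V : Type*} [Fintype V] {d : ℕ} {S T : Type*}
    [NormedAddCommGroup S] [NormedSpace ℝ S] [NormedAddCommGroup T] [NormedSpace ℝ T]
    (ι : S →L[ℝ] (EuclideanSpace ℝ (Fin d) →L[ℝ] EuclideanSpace ℝ (Fin d)))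
    (j : T →L[ℝ] Placement V d) {q : Placement V d} {f : ℝ × Placement V d → Placement V d}
    {f' : ℝ × Placement V d →L[ℝ] Placement V d} (hf : HasStrictFDerivAt f f' (0, q))
    (hfq : f (0, q) = q) :
    ∃ D : (S × EuclideanSpace ℝ (Fin d)) × ℝ × T →L[ℝ] Placement V d,
      HasStrictFDerivAt (fun z v => exp (ι z.1.1) (f (z.2.1, q + j z.2.2) v) + z.1.2) D 0 ∧
      ∀ z v, D z v = ι z.1.1 (q v) + z.1.2 + f' (z.2.1, j z.2.2) v := by
  let P := (S × EuclideanSpace ℝ (Fin d)) × ℝ × T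
  let π₁ : P →L[ℝ] S := ContinuousLinearMap.fst ℝ _ _ ∘L ContinuousLinearMap.fst ℝ _ _
  let π₂ : P →L[ℝ] EuclideanSpace ℝ (Fin d) :=
    ContinuousLinearMap.snd ℝ _ _ ∘L ContinuousLinearMap.fst ℝ _ _
  let π₃ : P →L[ℝ] ℝ × Placement V d :=
    ((ContinuousLinearMap.id ℝ ℝ).prodMap j) ∘L ContinuousLinearMap.snd ℝ _ _
  have hexp : HasStrictFDerivAt (fun z : P => exp (ι z.1.1)) (ι ∘L π₁) 0 := by
    have h1 : HasStrictFDerivAt (exp : (EuclideanSpace ℝ (Fin d) →L[ℝ] EuclideanSpace ℝ (Fin d)) → _)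
        (1 : _ →L[ℝ] _) ((ι ∘L π₁) 0) := by
      rw [map_zero]
      exact hasStrictFDerivAt_exp_zero
    exact h1.comp 0 (ι ∘L π₁).hasStrictFDerivAt
  have hflow : HasStrictFDerivAt (fun z : P => f (z.2.1, q + j z.2.2)) (f' ∘L π₃) 0 := by
    have h2 : HasStrictFDerivAt (fun z : P => ((0 : ℝ), q) + π₃ z) π₃ 0 :=
      π₃.hasStrictFDerivAt.const_add _
    have h3 : HasStrictFDerivAt f f' (((0 : ℝ), q) + π₃ 0) := by simpa using hf
    have h4 := h3.comp 0 h2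
    refine h4.congr_of_eventuallyEq (Eventually.of_forall fun z => ?_)
    change f ((0 : ℝ) + z.2.1, q + j z.2.2) = _
    rw [zero_add]
  refine ⟨ContinuousLinearMap.pi fun v => (ContinuousLinearMap.apply ℝ _ (q v)) ∘L ι ∘L π₁ + π₂ +
    ContinuousLinearMap.proj v ∘L f' ∘L π₃, hasStrictFDerivAt_pi'' fun v => ?_, fun z v => rfl⟩
  have hflow_v := (hasStrictFDerivAt_pi'.1 hflow) v
  have hsum := (hexp.clm_apply hflow_v).add π₂.hasStrictFDerivAt
  refine hsum.congr_fderiv (ContinuousLinearMap.ext fun z => Eq.symm ?_)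
  change ι z.1.1 (q v) + z.1.2 + f' (π₃ z) v =
    exp (ι 0) (f' (π₃ z) v) + ι z.1.1 (f (0, q + j 0) v) + z.1.2
  rw [ContinuousLinearMap.map_zero ι, exp_zero, ContinuousLinearMap.map_zero j, add_zero, hfq]
  change _ = f' (π₃ z) v + _ + _
  abel

/-- The maps `y = exp(A) (φ s (q + n)) + t` with small parameters cover a neighbourhood of `q`, as
soon as they do so to first order. -/
theorem IsGlobalFlow.eventually_exists_exp_apply {V : Type*} [Fintype V] {d : ℕ} {S T : Type*}
    [NormedAddCommGroup S] [NormedSpace ℝ S] [CompleteSpace S]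
    [NormedAddCommGroup T] [NormedSpace ℝ T] [CompleteSpace T]
    {W : Placement V d → Placement V d} {φ : ℝ → Placement V d → Placement V d}
    {K : NNReal} (hφ : IsGlobalFlow W φ) (hWK : LipschitzWith K W)
    (ι : S →L[ℝ] (EuclideanSpace ℝ (Fin d) →L[ℝ] EuclideanSpace ℝ (Fin d)))
    (j : T →L[ℝ] Placement V d) {q : Placement V d}
    (hspan : ∀ u : Placement V d, ∃ (A : S) (t : EuclideanSpace ℝ (Fin d)) (r : ℝ) (n : T),
      ∀ v, u v = ι A (q v) + t + r • W q v + j n v)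
    {Q : ℝ → T → Prop} (hQ : ∀ᶠ z : ℝ × T in 𝓝 0, Q z.1 z.2) :
    ∀ᶠ y in 𝓝 q, ∃ (A : S) (t : EuclideanSpace ℝ (Fin d)) (s : ℝ) (n : T), Q s n ∧
      ∀ v, y v = exp (ι A) (φ s (q + j n) v) + t := by
  obtain ⟨D, hD, hDapply⟩ := exists_hasStrictFDerivAt_exp_apply ι j
    (hφ.hasStrictFDerivAt_zero hWK q) (hφ.zero q)
  have hrange : D.range = ⊤ := by
    refine LinearMap.range_eq_top.2 fun u => ?_
    obtain ⟨A, t, r, n, hu⟩ := hspan u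
    refine ⟨((A, t), r, n), funext fun v => (hDapply _ v).trans ?_⟩
    rw [hu, add_assoc (ι A (q v) + t)]
    rfl
  have hmap := hD.map_nhds_eq_of_surj hrange
  have h0 : (fun v => exp (ι (0 : (S × EuclideanSpace ℝ (Fin d)) × ℝ × T).1.1)
      (φ (0 : (S × EuclideanSpace ℝ (Fin d)) × ℝ × T).2.1
        (q + j (0 : (S × EuclideanSpace ℝ (Fin d)) × ℝ × T).2.2) v) +
      (0 : (S × EuclideanSpace ℝ (Fin d)) × ℝ × T).1.2) = q := by
    ext1 v
    simp [hφ.zero]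
  rw [h0] at hmap
  rw [← hmap, eventually_map]
  have h1 : Tendsto (fun z : (S × EuclideanSpace ℝ (Fin d)) × ℝ × T => z.2) (𝓝 0) (𝓝 0) :=
    continuous_snd.tendsto 0
  filter_upwards [h1.eventually hQ] with z hz
  exact ⟨z.1.1, z.1.2, z.2.1, z.2.2, hz, fun v => rfl⟩

/-- Near a placement of the mechanism, all placements of the mechanism are obtained by flowing for
a short time and applying a rigid motion. -/
theorem IsGlobalFlow.eventually_exists_rigidMotion {V : Type*} [Fintype V] {d : ℕ}
    {Γ : SimpleGraph V} {W : Placement V d → Placement V d} {φ : ℝ → Placement V d → Placement V d}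
    {K : NNReal} (hφ : IsGlobalFlow W φ) (hWK : LipschitzWith K W)
    (hW : ∀ q, constraintMap Γ q (W q) = 0)
    (hdim : finrank ℝ (Placement V d) =
      finrank ℝ ((Γ.edgeSet → ℝ) × Dual ℝ (RigidVelocity d)) + 1)
    {q : Placement V d} (hq : Function.Injective (rigidVelocity q))
    (hsurj : Function.Surjective (constraintMap Γ q)) (hWq : W q ≠ 0) {ε : ℝ} (hε : 0 < ε) :
    ∀ᶠ y in 𝓝 q, (∀ v w, Γ.Adj v w → dist (y v) (y w) = dist (q v) (q w)) →
      ∃ s : ℝ, |s| < ε ∧ DiffersByTrivialMotion (φ s q) y := by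
  -- Rigid motions, the flow direction and a complement `N` of the infinitesimal motions together
  -- span all velocities.
  obtain ⟨N, hN⟩ := Submodule.exists_isCompl (LinearMap.ker (rigidityMap Γ q))
  obtain ⟨j, hj, hjN⟩ := N.exists_parametrization
  obtain ⟨ι, -, hι⟩ := (skewMaps (EuclideanSpace ℝ (Fin d))).exists_parametrization
  have hspan : ∀ u : Placement V d, ∃ A t, ∃ r : ℝ, ∃ n,
      ∀ v, u v = ι A (q v) + t + r • W q v + j n v := by
    intro u
    obtain ⟨k, hk, n, hn, rfl⟩ := Submodule.mem_sup.1
      ((hN.sup_eq_top ▸ Submodule.mem_top : u ∈ LinearMap.ker (rigidityMap Γ q) ⊔ N))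
    obtain ⟨z, r, rfl⟩ := exists_rigidVelocity_add_smul hq hdim hsurj (hW q) hWq hk
    obtain ⟨A, hA⟩ := (hι _).1 z.1.2
    obtain ⟨n, rfl⟩ := (hjN _).1 hn
    refine ⟨A, z.2, r, n, fun v => ?_⟩
    rw [hA]
    rfl
  have hjker : ∀ n, rigidityMap Γ q (j n) = 0 → n = 0 := fun n hn =>
    hj (((Submodule.disjoint_def.1 hN.disjoint) _ hn ((hjN _).2 ⟨n, rfl⟩)).trans (map_zero j).symm)
  have h1 : ∀ᶠ z : ℝ × (Fin (finrank ℝ N) → ℝ) in 𝓝 0, |z.1| < ε := by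
    have : ContinuousAt (fun z : ℝ × (Fin (finrank ℝ N) → ℝ) => |z.1|) 0 := by fun_prop
    exact this.eventually (gt_mem_nhds (by simpa using hε))
  have h2 := (continuous_snd.tendsto (0 : ℝ × (Fin (finrank ℝ N) → ℝ))).eventually
      (eventually_eq_zero_of_rigidityMap_eq Γ q j hjker)
  filter_upwards [hφ.eventually_exists_exp_apply hWK ι j hspan
    (Q := fun s n => |s| < ε ∧ ((∀ v w, Γ.Adj v w →
      dist ((q + j n) v) ((q + j n) w) = dist (q v) (q w)) → n = 0)) (h1.and h2)]
  rintro y ⟨A, t, s, n, ⟨hs, hn⟩, hy⟩ hdist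
  obtain ⟨R, hR, hRexp⟩ := exists_rotation_exp ((hι _).2 ⟨A, rfl⟩)
  have hy' : ∀ v, y v = R (φ s (q + j n) v) + t := fun v => by
    rw [hRexp, hy]
  -- Flow and rigid motions preserve edge lengths, so `q + j n` has those of `y`, hence of `q`;
  -- transversality gives `n = 0`.
  have hn0 : n = 0 := hn fun v w hvw => by
    rw [← hdist v w hvw, hy', hy', dist_add_right, R.dist_map, hφ.dist_eq hW _ _ hvw]
  refine ⟨s, hs, R, t, hR, fun v => ?_⟩
  rw [hy', hn0]
  simp

end

/-! ### Real actions with open orbit maps -/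

section

open Filter Topology Set

section RealAction

variable {X : Type*} [TopologicalSpace X] [AddAction ℝ X]

theorem isOpenMap_vadd_of_nhds
    (hnhds : ∀ x : X, ∀ ε > 0, (fun t : ℝ => t +ᵥ x) '' Ioo (-ε) ε ∈ 𝓝 x) (x : X) :
    IsOpenMap fun t : ℝ => t +ᵥ x := by
  refine isOpenMap_iff_nhds_le.2 fun t => ?_
  intro U hU
  obtain ⟨ε, hε, hεU⟩ := Metric.mem_nhds_iff.1 (mem_map.1 hU)
  refine mem_of_superset (hnhds (t +ᵥ x) ε hε) ?_
  rintro _ ⟨s, hs, rfl⟩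
  have : s + t ∈ Metric.ball t ε := by
    rw [Metric.mem_ball, Real.dist_eq, add_sub_cancel_right]
    exact abs_lt.2 hs
  simpa [add_vadd] using hεU this

/-- If the orbit maps of a real action are continuous and open, then the connected components are
the orbits. -/
theorem connectedComponent_eq_orbit (hcont : ∀ x : X, Continuous fun t : ℝ => t +ᵥ x)
    (hopen : ∀ x : X, IsOpenMap fun t : ℝ => t +ᵥ x) (x : X) :
    connectedComponent x = AddAction.orbit ℝ x := by
  have ho : ∀ y : X, IsOpen (AddAction.orbit ℝ y) := fun y => (hopen y).isOpen_range
  -- The complement of an orbit is a union of other orbits, all open.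
  have hc : IsClosed (AddAction.orbit ℝ x) := by
    rw [← isOpen_compl_iff, isOpen_iff_forall_mem_open]
    refine fun y hy => ⟨AddAction.orbit ℝ y, fun z hz hzx => hy ?_, ho y,
      AddAction.mem_orbit_self y⟩
    rw [← AddAction.orbit_eq_iff.2 hzx, AddAction.orbit_eq_iff.2 hz]
    exact AddAction.mem_orbit_self y
  refine Subset.antisymm
    (IsClopen.connectedComponent_subset ⟨hc, ho x⟩ (AddAction.mem_orbit_self x)) ?_
  exact (isPreconnected_range (hcont x)).subset_connectedComponent (AddAction.mem_orbit_self x)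

theorem finite_connectedComponents_of_isOpenMap_vadd [CompactSpace X]
    (hcont : ∀ x : X, Continuous fun t : ℝ => t +ᵥ x)
    (hopen : ∀ x : X, IsOpenMap fun t : ℝ => t +ᵥ x) : Finite (ConnectedComponents X) := by
  have : DiscreteTopology (ConnectedComponents X) :=
    ConnectedComponents.discreteTopology_iff.2 fun x => by
      rw [connectedComponent_eq_orbit hcont hopen]
      exact (hopen x).isOpen_range
  exact finite_of_compact_of_discrete

/-- A subgroup of `ℝ` is dense or cyclic. A trivial stabilizer would embed `ℝ` onto a connected
component, which is closed in a compact space and hence compact. -/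
theorem exists_period_of_isOpenMap_vadd [CompactSpace X]
    (hcont : ∀ x : X, Continuous fun t : ℝ => t +ᵥ x)
    (hopen : ∀ x : X, IsOpenMap fun t : ℝ => t +ᵥ x) {x : X}
    (hx : ¬ Dense {t : ℝ | t +ᵥ x = x}) :
    ∃ c : ℝ, 0 < c ∧ ∀ s t : ℝ, s +ᵥ x = t +ᵥ x ↔ ∃ n : ℤ, s - t = n • c := by
  obtain ⟨c, hc⟩ := (AddSubgroup.dense_or_cyclic (AddAction.stabilizer ℝ x)).resolve_left hx
  have hst : ∀ s t : ℝ, s +ᵥ x = t +ᵥ x ↔ ∃ n : ℤ, s - t = n • c := by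
    intro s t
    have h1 : s +ᵥ x = t +ᵥ x ↔ s - t ∈ AddAction.stabilizer ℝ x := by
      rw [AddAction.mem_stabilizer_iff, sub_eq_neg_add, add_vadd, neg_vadd_eq_iff]
    rw [h1, hc, AddSubgroup.mem_closure_singleton]
    simp only [eq_comm]
  rcases eq_or_ne c 0 with rfl | hc0
  · exfalso
    have hinj : Function.Injective fun t : ℝ => t +ᵥ x := fun s t hs => by
      obtain ⟨n, hn⟩ := (hst s t).1 hs
      simpa [sub_eq_zero] using hn
    have hemb := IsOpenEmbedding.of_continuous_injective_isOpenMap (hcont x) hinj (hopen x)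
    have hclosed : IsClosed (range fun t : ℝ => t +ᵥ x) := by
      change IsClosed (AddAction.orbit ℝ x)
      rw [← connectedComponent_eq_orbit hcont hopen]
      exact isClosed_connectedComponent
    have hcompact := hclosed.isCompact
    rw [← image_univ, ← hemb.isInducing.isCompact_iff] at hcompact
    exact noncompact_univ ℝ hcompact
  · refine ⟨|c|, abs_pos.2 hc0, fun s t => (hst s t).trans ?_⟩
    rcases abs_choice c with h | h <;> rw [h]
    constructor <;> rintro ⟨n, hn⟩ <;> exact ⟨-n, by simpa using hn⟩

/-- The orbit map factors through a continuous bijection from `ℝ / cℤ`; it is open since orbit maps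
are, so no separation property of `X` is required. -/
theorem nonempty_connectedComponent_homeomorph_circle
    (hcont : ∀ x : X, Continuous fun t : ℝ => t +ᵥ x)
    (hopen : ∀ x : X, IsOpenMap fun t : ℝ => t +ᵥ x) {x : X} {c : ℝ} (hc : 0 < c)
    (hst : ∀ s t : ℝ, s +ᵥ x = t +ᵥ x ↔ ∃ n : ℤ, s - t = n • c) :
    Nonempty (connectedComponent x ≃ₜ Circle) := by
  rw [connectedComponent_eq_orbit hcont hopen]
  let θ : ℝ → AddAction.orbit ℝ x := fun t => ⟨t +ᵥ x, t, rfl⟩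
  have hθc : Continuous θ := (hcont x).subtype_mk _
  have hθo : IsOpenMap θ := fun U hU => by
    rw [isOpen_induced_iff]
    refine ⟨_, hopen x U hU, ?_⟩
    ext y
    simp [θ, Subtype.ext_iff]
  have hθ : ∀ s t : ℝ, θ s = θ t ↔ (s : AddCircle c) = t := by
    intro s t
    rw [Subtype.ext_iff]
    refine (hst s t).trans ?_
    rw [eq_comm (a := (s : AddCircle c)), QuotientAddGroup.eq, AddSubgroup.mem_zmultiples_iff,
      ← sub_eq_neg_add]
    simp only [eq_comm]
  let Θ : AddCircle c → AddAction.orbit ℝ x := Quotient.lift θ fun s t h =>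
    (hθ s t).2 (Quotient.sound h)
  have hΘ : ∀ t : ℝ, Θ t = θ t := fun t => rfl
  have hbij : Function.Bijective Θ := by
    constructor
    · intro s t
      induction s using QuotientAddGroup.induction_on with | H s => ?_
      induction t using QuotientAddGroup.induction_on with | H t => ?_
      exact fun h => (hθ s t).1 h
    · rintro ⟨_, t, rfl⟩
      exact ⟨(t : AddCircle c), rfl⟩
  have hΘc : Continuous Θ := hθc.quotient_lift _
  have hΘo : IsOpenMap Θ :=
    IsOpenMap.of_comp (f := ((↑) : ℝ → AddCircle c)) continuous_quotient_mk'
      Quotient.mk_surjective hθo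
  exact ⟨((Equiv.ofBijective Θ hbij).toHomeomorphOfContinuousOpen hΘc hΘo).symm.trans
    (AddCircle.homeomorphCircle hc.ne')⟩

/-- On a closed orbit, a function with simple zeros has finitely many zeros, and their number is
even. -/
theorem finite_and_even_ncard_zeros
    (hcont : ∀ x : X, Continuous fun t : ℝ => t +ᵥ x)
    (hopen : ∀ x : X, IsOpenMap fun t : ℝ => t +ᵥ x) {x : X} {c : ℝ} (hc : 0 < c)
    (hst : ∀ s t : ℝ, s +ᵥ x = t +ᵥ x ↔ ∃ n : ℤ, s - t = n • c) {f : X → ℝ}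
    (hf : Continuous fun t : ℝ => f (t +ᵥ x))
    (hd : ∀ t : ℝ, f (t +ᵥ x) = 0 → ∃ f', f' ≠ 0 ∧ HasDerivAt (fun t : ℝ => f (t +ᵥ x)) f' t) :
    {y ∈ connectedComponent x | f y = 0}.Finite ∧
      Even {y ∈ connectedComponent x | f y = 0}.ncard := by
  rw [connectedComponent_eq_orbit hcont hopen]
  have hper : Function.Periodic (fun t : ℝ => f (t +ᵥ x)) c := fun t =>
    congrArg f ((hst _ _).2 ⟨1, by simp⟩)
  obtain ⟨a, s, hs, heven⟩ := hper.exists_even_card_zeros hc hf hd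
  -- A half-open period meets every point of the orbit exactly once.
  have hset : {y ∈ AddAction.orbit ℝ x | f y = 0} = (fun t : ℝ => t +ᵥ x) '' (s : Set ℝ) := by
    ext y
    constructor
    · rintro ⟨⟨t, rfl⟩, ht⟩
      have hmod : toIcoMod hc a t +ᵥ x = t +ᵥ x :=
        (hst _ _).2 ⟨-toIcoDiv hc a t, by rw [toIcoMod_sub_self]⟩
      exact ⟨toIcoMod hc a t, (hs _).2 ⟨toIcoMod_mem_Ico hc a t, (congrArg f hmod).trans ht⟩, hmod⟩
    · rintro ⟨t, ht, rfl⟩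
      exact ⟨⟨t, rfl⟩, ((hs t).1 ht).2⟩
  have hinj : InjOn (fun t : ℝ => t +ᵥ x) (s : Set ℝ) := by
    intro t ht u hu htu
    obtain ⟨n, hn⟩ := (hst t u).1 htu
    have h1 := ((hs t).1 ht).1
    have h2 := ((hs u).1 hu).1
    have h3 := (toIcoMod_eq_self hc).2 h1
    have h4 := (toIcoMod_eq_self hc).2 h2
    rw [← h3, ← h4, ← sub_add_cancel t u, hn, add_comm, toIcoMod_add_zsmul]
  rw [hset]
  refine ⟨s.finite_toSet.image _, ?_⟩
  rwa [hinj.ncard_image, ncard_coe_finset]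

end RealAction

end

/-! ### The configuration space as a quotient -/

section

open Filter Topology Set

section Configuration

variable {V : Type*} {d : ℕ} {Γ : SimpleGraph V} {p : Placement V d}

/-- The configuration represented by a placement. -/
def EquivalentPlacements.configuration (q : EquivalentPlacements Γ p) : ConfigurationSpace Γ p :=
  Quotient.mk _ q

theorem EquivalentPlacements.continuous_configuration :
    Continuous (EquivalentPlacements.configuration (Γ := Γ) (p := p)) :=
  continuous_quotient_mk'

theorem EquivalentPlacements.configuration_surjective :
    Function.Surjective (EquivalentPlacements.configuration (Γ := Γ) (p := p)) :=
  Quotient.mk_surjective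

theorem EquivalentPlacements.configuration_eq_iff {q q' : EquivalentPlacements Γ p} :
    q.configuration = q'.configuration ↔ DiffersByTrivialMotion q.1 q'.1 :=
  Quotient.eq (r := trivialMotionSetoid Γ p)

/-- The equivalence classes are orbits of a group acting by continuous maps, so the saturation of an
open set is open. -/
theorem EquivalentPlacements.isOpenMap_configuration :
    IsOpenMap (EquivalentPlacements.configuration (Γ := Γ) (p := p)) := by
  intro U hU
  change IsOpen (configuration ⁻¹' (configuration '' U))
  refine isOpen_iff_mem_nhds.2 fun y hy => ?_
  obtain ⟨u, hu, huy⟩ := hy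
  obtain ⟨R, t, hR, h⟩ := configuration_eq_iff.1 huy.symm
  let g : EquivalentPlacements Γ p → EquivalentPlacements Γ p := fun z =>
    ⟨fun v => R (z.1 v) + t, fun v w hvw => by simpa using z.2 v w hvw⟩
  have hg : Continuous g := by
    refine Continuous.subtype_mk (continuous_pi fun v => ?_) _
    exact (R.continuous.comp ((continuous_apply v).comp continuous_subtype_val)).add
      continuous_const
  have hgy : g y = u := Subtype.ext (funext fun v => (h v).symm)
  have hU' : g ⁻¹' U ∈ 𝓝 y := hg.continuousAt.preimage_mem_nhds (by rw [hgy]; exact hU.mem_nhds hu)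
  filter_upwards [hU'] with z hz
  exact ⟨g z, hz, (configuration_eq_iff.2 ⟨R, t, hR, fun v => rfl⟩).symm⟩

variable [Fintype V]

/-- The configuration represented by a placement with centroid at the origin. -/
def centeredConfiguration (q : centeredFiber Γ p) : ConfigurationSpace Γ p :=
  EquivalentPlacements.configuration ⟨q.1, q.2.1⟩

theorem continuous_centeredConfiguration :
    Continuous (centeredConfiguration (Γ := Γ) (p := p)) :=
  EquivalentPlacements.continuous_configuration.comp
    (Continuous.subtype_mk continuous_subtype_val _)

theorem centeredConfiguration_surjective [Nonempty V] :
    Function.Surjective (centeredConfiguration (Γ := Γ) (p := p)) := by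
  intro x
  obtain ⟨q, rfl⟩ := EquivalentPlacements.configuration_surjective x
  let m : EuclideanSpace ℝ (Fin d) := (Fintype.card V : ℝ)⁻¹ • ∑ v, q.1 v
  refine ⟨⟨fun v => q.1 v - m, fun v w hvw => by simpa using q.2 v w hvw, ?_⟩, ?_⟩
  · have : (Fintype.card V : ℝ) ≠ 0 := by exact_mod_cast Fintype.card_ne_zero
    rw [Finset.sum_sub_distrib, Finset.sum_const, Finset.card_univ, ← Nat.cast_smul_eq_nsmul ℝ,
      smul_inv_smul₀ this, sub_self]
  · refine EquivalentPlacements.configuration_eq_iff.2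
      ⟨LinearIsometryEquiv.refl ℝ _, m, LinearMap.det_id, fun v => ?_⟩
    simp

/-- Comparing centroids kills the translation, so only rotations remain to be divided out. -/
theorem centeredConfiguration_eq_iff [Nonempty V] {q q' : centeredFiber Γ p} :
    centeredConfiguration q = centeredConfiguration q' ↔
      ∃ R : EuclideanSpace ℝ (Fin d) ≃ₗᵢ[ℝ] EuclideanSpace ℝ (Fin d),
        LinearMap.det
          (R.toLinearEquiv : EuclideanSpace ℝ (Fin d) →ₗ[ℝ] EuclideanSpace ℝ (Fin d)) = 1 ∧
        q'.1 = placementAction V d R q.1 := by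
  refine EquivalentPlacements.configuration_eq_iff.trans ⟨?_, ?_⟩
  · rintro ⟨R, t, hR, h⟩
    have ht : t = 0 := by
      have h1 : ∑ v, q'.1 v = R (∑ v, q.1 v) + (Fintype.card V : ℝ) • t := by
        rw [Finset.sum_congr rfl fun v _ => h v, Finset.sum_add_distrib, map_sum, Finset.sum_const,
          Finset.card_univ, Nat.cast_smul_eq_nsmul]
      rw [q'.2.2, q.2.2, map_zero, zero_add] at h1
      exact (smul_eq_zero.1 h1.symm).resolve_left (by exact_mod_cast Fintype.card_ne_zero)
    refine ⟨R, hR, funext fun v => ?_⟩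
    simpa [ht] using h v
  · rintro ⟨R, hR, h⟩
    exact ⟨R, 0, hR, fun v => by simp [h]⟩

/-- A flow that preserves the centered placements and commutes with rotations acts on the
configuration space. -/
theorem exists_addAction_configurationSpace [Nonempty V] {φ : ℝ → Placement V d → Placement V d}
    (h0 : ∀ q, φ 0 q = q) (hadd : ∀ s t q, φ (s + t) q = φ s (φ t q))
    (hmem : ∀ t, ∀ q ∈ centeredFiber Γ p, φ t q ∈ centeredFiber Γ p)
    (hφ : ∀ (R : EuclideanSpace ℝ (Fin d) ≃ₗᵢ[ℝ] EuclideanSpace ℝ (Fin d)),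
      LinearMap.det
        (R.toLinearEquiv : EuclideanSpace ℝ (Fin d) →ₗ[ℝ] EuclideanSpace ℝ (Fin d)) = 1 →
      ∀ t q, φ t (placementAction V d R q) = placementAction V d R (φ t q)) :
    ∃ _ : AddAction ℝ (ConfigurationSpace Γ p), ∀ (t : ℝ) (q : centeredFiber Γ p),
      t +ᵥ centeredConfiguration q = centeredConfiguration ⟨φ t q, hmem t q q.2⟩ := by
  -- An arbitrary choice of representatives; equivariance under rotations makes the action
  -- independent of it.
  let ρ := Function.surjInv (centeredConfiguration_surjective (Γ := Γ) (p := p))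
  have hρ : ∀ x, centeredConfiguration (ρ x) = x := Function.surjInv_eq _
  let A : ℝ → ConfigurationSpace Γ p → ConfigurationSpace Γ p := fun t x =>
    centeredConfiguration ⟨φ t (ρ x), hmem t _ (ρ x).2⟩
  have hA : ∀ (t : ℝ) (q : centeredFiber Γ p),
      A t (centeredConfiguration q) = centeredConfiguration ⟨φ t q, hmem t q q.2⟩ := by
    intro t q
    obtain ⟨R, hR, h⟩ := centeredConfiguration_eq_iff.1 (hρ (centeredConfiguration q))
    refine centeredConfiguration_eq_iff.2 ⟨R, hR, ?_⟩
    change φ t q = placementAction V d R (φ t (ρ (centeredConfiguration q)))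
    rw [h, hφ R hR]
  have hA0 : ∀ x, A 0 x = x := fun x => by
    obtain ⟨q, rfl⟩ := centeredConfiguration_surjective x
    exact (hA 0 q).trans (congrArg _ (Subtype.ext (h0 q)))
  have hAadd : ∀ s t x, A (s + t) x = A s (A t x) := fun s t x => by
    obtain ⟨q, rfl⟩ := centeredConfiguration_surjective x
    have h : A s (A t (centeredConfiguration q)) =
        centeredConfiguration ⟨φ s (φ t q), hmem s _ (hmem t q q.2)⟩ :=
      (congrArg (A s) (hA t q)).trans (hA s ⟨φ t q, hmem t q q.2⟩)
    refine (hA (s + t) q).trans (Eq.trans ?_ h.symm)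
    congr 2
    exact hadd s t q
  exact ⟨{ vadd := A, zero_vadd := hA0, add_vadd := hAadd }, hA⟩

/-- A set of configurations is a neighbourhood as soon as the placements representing it are one. -/
theorem mem_nhds_centeredConfiguration (q : centeredFiber Γ p) {S : Set (ConfigurationSpace Γ p)}
    (hS : ∀ᶠ y in 𝓝 q.1, ∀ hy : ∀ v w, Γ.Adj v w → dist (y v) (y w) = dist (p v) (p w),
      EquivalentPlacements.configuration ⟨y, hy⟩ ∈ S) :
    S ∈ 𝓝 (centeredConfiguration q) := by
  have h1 : Continuous (Subtype.val : EquivalentPlacements Γ p → Placement V d) :=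
    continuous_subtype_val
  have h2 : ∀ᶠ y : EquivalentPlacements Γ p in 𝓝 ⟨q.1, q.2.1⟩, y.configuration ∈ S :=
    (h1.continuousAt.eventually hS).mono fun y hy => hy y.2
  exact mem_of_superset (EquivalentPlacements.isOpenMap_configuration.image_mem_nhds h2)
    (by rintro _ ⟨y, hy, rfl⟩; exact hy)

theorem compactSpace_configurationSpace [Nonempty V] (hΓ : Γ.Preconnected) (p : Placement V d) :
    CompactSpace (ConfigurationSpace Γ p) := by
  have := isCompact_iff_compactSpace.1 (isCompact_centeredFiber hΓ p)
  exact centeredConfiguration_surjective.compactSpace continuous_centeredConfiguration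

end Configuration

section Flow

variable {V : Type*} [Fintype V] {d : ℕ} {Γ : SimpleGraph V} {p : Placement V d}
  {W : Placement V d → Placement V d} {φ : ℝ → Placement V d → Placement V d}

/-- A placement moved by the flow does not return to its configuration for a dense set of times. -/
theorem IsGlobalFlow.eq_zero_of_dense (hφ : IsGlobalFlow W φ)
    (hW : ∀ q, constraintMap Γ q (W q) = 0) {q : Placement V d} (hq : ∑ v, q v = 0)
    (hdense : Dense {t : ℝ | ∀ v w, dist (φ t q v) (φ t q w) = dist (q v) (q w)}) : W q = 0 := by
  -- A closed dense set of times is everything, so all distances are constant along the orbit.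
  have hclosed : IsClosed {t : ℝ | ∀ v w, dist (φ t q v) (φ t q w) = dist (q v) (q w)} := by
    simp only [ofPred_forall]
    have hc := continuous_pi_iff.1 (hφ.continuous_left q)
    exact isClosed_iInter fun v => isClosed_iInter fun w =>
      isClosed_eq ((hc v).dist (hc w)) continuous_const
  have hall : ∀ t v w, dist (φ t q v) (φ t q w) = dist (q v) (q w) := fun t =>
    (hclosed.closure_eq ▸ hdense.closure_eq ▸ mem_univ t :)
  have hd := hφ.deriv q 0
  rw [hφ.zero] at hd
  refine eq_zero_of_momentMap_of_dist_const hd ?_ (fun t => (hφ.sum_eq hW q t).trans hq) ?_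
  · rw [hφ.zero]
    exact (constraintMap_eq_zero_iff.1 (hW q)).2
  · intro t v w
    rw [hφ.zero]
    exact hall t v w

end Flow

end

/-! ### The main theorem -/

open Filter Topology Set

theorem theorem2 {V : Type*} [Fintype V] {d : ℕ} (hd : 2 ≤ d) (hV : d + 1 ≤ Fintype.card V)
    (G : SimpleGraph V) (p : Placement V d) (hgen : IsGenericPlacement p) (hiso : IsIsostatic G p)
    (a b : V) (hab : G.Adj a b) :
    Finite (ConnectedComponents (ConfigurationSpace (G.deleteEdges {s(a, b)}) p)) ∧
    ∀ x : ConfigurationSpace (G.deleteEdges {s(a, b)}) p,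
      Nonempty (connectedComponent x ≃ₜ Circle) ∧
      {y ∈ connectedComponent x | y.vertexDist a b = dist (p a) (p b)}.Finite ∧
      Even {y ∈ connectedComponent x | y.vertexDist a b = dist (p a) (p b)}.ncard := by
  have : Nonempty V := ⟨a⟩
  obtain ⟨W, K, L, hWK, hWL, hW, hW0, hWR⟩ := hiso.exists_vectorField hgen hd hV hab
  set H := G.deleteEdges {s(a, b)} with hH
  obtain ⟨φ, hφ⟩ := exists_isGlobalFlow hWK hWL
  obtain ⟨_, hA⟩ := exists_addAction_configurationSpace (Γ := H) (p := p) hφ.zero (hφ.add hWK)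
    (fun t q hq => hφ.mem_centeredFiber hW hq t)
    (fun R hR t q => hφ.map_linear hWK (placementAction V d R).toContinuousLinearMap
      (fun q => hWR R q hR) t q)
  have := compactSpace_configurationSpace (hiso.preconnected_deleteEdges hd hV a b) p
  have hcont : ∀ x : ConfigurationSpace H p, Continuous fun t : ℝ => t +ᵥ x := by
    intro x
    obtain ⟨q, rfl⟩ := centeredConfiguration_surjective x
    simp only [hA]
    exact continuous_centeredConfiguration.comp ((hφ.continuous_left q).subtype_mk _)
  have hopen : ∀ x : ConfigurationSpace H p, IsOpenMap fun t : ℝ => t +ᵥ x := by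
    refine isOpenMap_vadd_of_nhds fun x ε hε => ?_
    obtain ⟨q, rfl⟩ := centeredConfiguration_surjective x
    refine mem_nhds_centeredConfiguration q ?_
    filter_upwards [hφ.eventually_exists_rigidMotion hWK hW
      (hiso.finrank_placement_deleteEdges hV hab)
      (hiso.rigidVelocity_injective hgen hV hab q.2.1)
      (hiso.constraintMap_surjective hgen hV hab q.2.1) (hW0 q q.2) hε] with y hy hyp
    obtain ⟨s, hs, hsy⟩ := hy fun v w hvw => (hyp v w hvw).trans (q.2.1 v w hvw).symm
    refine ⟨s, abs_lt.1 hs, ?_⟩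
    change s +ᵥ centeredConfiguration q = _
    rw [hA]
    exact EquivalentPlacements.configuration_eq_iff.2 hsy
  refine ⟨finite_connectedComponents_of_isOpenMap_vadd hcont hopen, fun x => ?_⟩
  obtain ⟨q, rfl⟩ := centeredConfiguration_surjective x
  have hdense : ¬ Dense {t : ℝ | t +ᵥ centeredConfiguration q = centeredConfiguration q} := by
    refine fun hdense => hW0 q q.2 (hφ.eq_zero_of_dense hW q.2.2 (hdense.mono fun t ht v w => ?_))
    have h := congrArg (fun y => y.vertexDist v w) ((hA t q).symm.trans ht)
    exact h
  obtain ⟨c, hc, hst⟩ := exists_period_of_isOpenMap_vadd hcont hopen hdense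
  refine ⟨nonempty_connectedComponent_homeomorph_circle hcont hopen hc hst, ?_⟩
  -- Squared lengths are differentiable along the flow everywhere, even where `a` and `b` coincide.
  let f : ConfigurationSpace H p → ℝ := fun y => y.vertexDist a b ^ 2 - dist (p a) (p b) ^ 2
  have hft : ∀ t : ℝ, f (t +ᵥ centeredConfiguration q) =
      dist (φ t q a) (φ t q b) ^ 2 - dist (p a) (p b) ^ 2 := fun t => by rw [hA]; rfl
  have hderiv : ∀ t, HasDerivAt (fun t : ℝ => f (t +ᵥ centeredConfiguration q))
      (2 * inner ℝ (φ t q a - φ t q b) (W (φ t q) a - W (φ t q) b)) t := fun t => by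
    simp only [hft]
    exact (hφ.hasDerivAt_dist_sq q a b t).sub_const _
  have hsqrt : ∀ y : ConfigurationSpace H p, f y = 0 ↔ y.vertexDist a b = dist (p a) (p b) := by
    intro y
    obtain ⟨r, rfl⟩ := centeredConfiguration_surjective y
    exact sub_eq_zero.trans (sq_eq_sq₀ dist_nonneg dist_nonneg)
  simp only [← hsqrt]
  refine finite_and_even_ncard_zeros hcont hopen hc hst
    (continuous_iff_continuousAt.2 fun t => (hderiv t).continuousAt) fun t ht =>
      ⟨_, fun h0 => ?_, hderiv t⟩
  have hmem := hφ.mem_centeredFiber hW q.2 t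
  have hab_length : dist (φ t q a) (φ t q b) = dist (p a) (p b) := by
    rw [hA, hsqrt] at ht
    exact ht
  have hadj : ∀ {v w}, G.Adj v w → H.Adj v w ∨ s(v, w) = s(a, b) := fun {v w} hvw => by
    rw [hH, SimpleGraph.deleteEdges_adj]
    simp only [mem_singleton_iff]
    tauto
  have hlength : ∀ v w, G.Adj v w → dist (φ t q v) (φ t q w) = dist (p v) (p w) := by
    intro v w hvw
    rcases hadj hvw with h | h
    · exact hmem.1 v w h
    · rcases Sym2.eq_iff.1 h with ⟨rfl, rfl⟩ | ⟨rfl, rfl⟩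
      · exact hab_length
      · rw [dist_comm, hab_length, dist_comm]
  -- A zero of `f` with zero derivative would put `W (φ t q)` in the kernel of the constraint map of
  -- the whole of `G`, which is trivial at a placement with all original edge lengths.
  refine hW0 _ hmem (hiso.constraintMap_injective hgen hV hab hlength
    ((constraintMap_eq_zero_iff.2 ⟨?_, (constraintMap_eq_zero_iff.1 (hW _)).2⟩).trans
      (map_zero _).symm))
  refine mem_ker_rigidityMap.2 fun v w hvw => ?_
  have hHW := mem_ker_rigidityMap.1 (constraintMap_eq_zero_iff.1 (hW (φ t q))).1
  have hab0 : inner ℝ (φ t q a - φ t q b) (W (φ t q) a - W (φ t q) b) = (0 : ℝ) := by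
    simpa using h0
  rcases hadj hvw with h | h
  · exact hHW v w h
  · rcases Sym2.eq_iff.1 h with ⟨rfl, rfl⟩ | ⟨rfl, rfl⟩
    · exact hab0
    · rw [← neg_sub, ← neg_sub (W _ w), inner_neg_neg, hab0]
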